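/- Let $n\in\mathbb N$, $T>0$, and consider the third order operator $\partial_t^3+\sum_{j=0}^{2}\sum_{|\alpha|\le 3-j}a_{j,\alpha}(t)\,\partial_t^j\partial_x^\alpha$ on $[0,T]\times\mathbb R^n$, whose coefficients are analytic in a neighbourhood of $[0,T]$, real valued for $j+|\alpha|=3$ and possibly complex valued for $j+|\alpha|\le 2$. Set $$L=\tau^3+\sum_{j+|\alpha|=3}a_{j,\alpha}\tau^j\xi^\alpha,\quad M=\sum_{j+|\alpha|=2}a_{j,\alpha}\tau^j\xi^\alpha,\quad N=\sum_{j+|\alpha|=1}a_{j,\alpha}\tau^j\xi^\alpha,$$ where $j\le 2$ in all sums, and $$\check N=N-\tfrac12\,\partial_t\partial_\tau M+\tfrac1{12}\,\partial_t^2\partial_\tau^2L,\qquad \mathcal L=L-\partial_\tau^2L .$$ Assume that for all $t\in[0,T]$, $\xi\in\mathbb R^n$ the polynomial $L(t,\cdot,\xi)$ has only real roots. Let $\sigma_1\le\sigma_2$ be the roots of $\partial_\tau L(t,\cdot,\xi)$, let $\mu_1<\mu_2$ be the roots of $\partial_\tau\mathcal L(t,\cdot,\xi)$ (all of them are then real),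 put $\Delta(t,\xi)=(\sigma_1(t,\xi)-\sigma_2(t,\xi))^2$, and assume that $\Delta\not\equiv0$ on $[0,T]\times\mathbb R^n$. Consider the following conditions. (A) There is $C>0$ such that, for $j=1,2$ and all $(t,\xi)\in[0,T]\times\mathbb R^n$ with $\Delta(t,\xi)\ne0$, $$|\check N(t,\sigma_j(t,\xi),\xi)|\le C\Bigl(\sqrt{\Delta(t,\xi)}+\frac{(\partial_t\Delta(t,\xi))^2}{\Delta(t,\xi)^{3/2}}\Bigr).$$ (B) (Levi condition) There is $C>0$ such that, for all $\xi\in\mathbb R^n$ with $|\xi|\ge1$, $$\int_0^T\sum_{j=1}^2\sqrt{\frac{|\check N(t,\mu_j(t,\xi),\xi)|}{|\mu_2(t,\xi)-\mu_1(t,\xi)|}}\;dt\le C\log(1+|\xi|).$$ (C) There are finitely many pairwise distinct real numbers $t_1,\dots,t_\nu$ and $C>0$ such that, for all $(t,\xi)\in[0,T]\times\mathbb R^n$, $$\prod_{j=1}^\nu(t-t_j)^2\;|\check N(t,\sigma_1(t,\xi),\xi)|\le C\,|\sigma_2(t,\xi)-\sigma_1(t,\xi)| .$$ Then (A) implies (B).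 If $n=1$, then (A), (B) and (C) are equivalent. -/

import Mathlib

/-- The coefficients `a_{j,α}(t)`, `0 ≤ j ≤ 2`, `j + |α| ≤ 3`, of the operator
`∂ₜ³ + ∑_{j ≤ 2} ∑_{|α| ≤ 3 - j} a_{j,α}(t) ∂ₜʲ ∂ₓ^α` in space dimension `n`. Those with
`j + |α| = 3` are real valued (field `lead`), the others may be complex valued (field `lower`).
Values of the two families at other indices `(j, α)` are never used. -/
structure ThirdOrderOperator (n : ℕ) where
  lead : ℕ → (Fin n → ℕ) → ℝ → ℝ
  lower : ℕ → (Fin n → ℕ) → ℝ → ℂ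

namespace ThirdOrderOperator

variable {n : ℕ} (P : ThirdOrderOperator n)

/-- The monomial `ξ^α`. -/
def monom (ξ : EuclideanSpace ℝ (Fin n)) (α : Fin n → ℕ) : ℝ := ∏ i, ξ i ^ α i

/-- `L(t,τ,ξ) = τ³ + ∑_{j + |α| = 3} a_{j,α}(t) τ^j ξ^α`. The finset
`Finset.piAntidiag Finset.univ k` consists of the multi-indices `α` with `|α| = k`. -/
def symL (t τ : ℝ) (ξ : EuclideanSpace ℝ (Fin n)) : ℝ :=
  τ ^ 3 + ∑ j ∈ Finset.range 3, ∑ α ∈ Finset.piAntidiag Finset.univ (3 - j),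
    P.lead j α t * τ ^ j * monom ξ α

/-- `M(t,τ,ξ) = ∑_{j + |α| = 2} a_{j,α}(t) τ^j ξ^α`. -/
def symM (t τ : ℝ) (ξ : EuclideanSpace ℝ (Fin n)) : ℂ :=
  ∑ j ∈ Finset.range 3, ∑ α ∈ Finset.piAntidiag Finset.univ (2 - j),
    P.lower j α t * (τ : ℂ) ^ j * (monom ξ α : ℂ)

/-- `N(t,τ,ξ) = ∑_{j + |α| = 1} a_{j,α}(t) τ^j ξ^α`. -/
def symN (t τ : ℝ) (ξ : EuclideanSpace ℝ (Fin n)) : ℂ :=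
  ∑ j ∈ Finset.range 2, ∑ α ∈ Finset.piAntidiag Finset.univ (1 - j),
    P.lower j α t * (τ : ℂ) ^ j * (monom ξ α : ℂ)

/-- `Ň = N - (1/2) ∂ₜ ∂_τ M + (1/12) ∂ₜ² ∂_τ² L`. -/
noncomputable def symNcheck (t τ : ℝ) (ξ : EuclideanSpace ℝ (Fin n)) : ℂ :=
  P.symN t τ ξ
    - (1 / 2 : ℂ) * deriv (fun s : ℝ => deriv (fun z : ℝ => P.symM s z ξ) τ) t
    + (1 / 12 : ℂ) *
      ((iteratedDeriv 2 (fun s : ℝ => iteratedDeriv 2 (fun z : ℝ => P.symL s z ξ) τ) t : ℝ) : ℂ)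

/-- The auxiliary polynomial `𝓛 = L - ∂_τ² L`. -/
noncomputable def symLaux (t τ : ℝ) (ξ : EuclideanSpace ℝ (Fin n)) : ℝ :=
  P.symL t τ ξ - iteratedDeriv 2 (fun z : ℝ => P.symL t z ξ) τ

/-- `∂_τ L`. -/
noncomputable def dL (t τ : ℝ) (ξ : EuclideanSpace ℝ (Fin n)) : ℝ :=
  deriv (fun z : ℝ => P.symL t z ξ) τ

/-- `∂_τ 𝓛`. -/
noncomputable def dLaux (t τ : ℝ) (ξ : EuclideanSpace ℝ (Fin n)) : ℝ :=
  deriv (fun z : ℝ => P.symLaux t z ξ) τ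

/-- The smaller root `σ₁(t,ξ)` of the quadratic polynomial `∂_τ L(t,·,ξ)`. -/
noncomputable def σ₁ (t : ℝ) (ξ : EuclideanSpace ℝ (Fin n)) : ℝ := sInf {τ | P.dL t τ ξ = 0}

/-- The larger root `σ₂(t,ξ)` of the quadratic polynomial `∂_τ L(t,·,ξ)`. -/
noncomputable def σ₂ (t : ℝ) (ξ : EuclideanSpace ℝ (Fin n)) : ℝ := sSup {τ | P.dL t τ ξ = 0}

/-- The smaller root `μ₁(t,ξ)` of the quadratic polynomial `∂_τ 𝓛(t,·,ξ)`. -/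
noncomputable def μ₁ (t : ℝ) (ξ : EuclideanSpace ℝ (Fin n)) : ℝ := sInf {τ | P.dLaux t τ ξ = 0}

/-- The larger root `μ₂(t,ξ)` of the quadratic polynomial `∂_τ 𝓛(t,·,ξ)`. -/
noncomputable def μ₂ (t : ℝ) (ξ : EuclideanSpace ℝ (Fin n)) : ℝ := sSup {τ | P.dLaux t τ ξ = 0}

/-- The discriminant `Δ_{∂_τ L}(t,ξ) = (σ₁(t,ξ) - σ₂(t,ξ))²` of `∂_τ L`. -/
noncomputable def Δ (t : ℝ) (ξ : EuclideanSpace ℝ (Fin n)) : ℝ := (P.σ₁ t ξ - P.σ₂ t ξ) ^ 2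

/-- All coefficients are (real-)analytic in `t` on a neighbourhood of `[0,T]`. -/
def AnalyticCoefficients (T : ℝ) : Prop :=
  (∀ (j : ℕ) (α : Fin n → ℕ), j < 3 → j + ∑ i, α i = 3 →
      AnalyticOnNhd ℝ (P.lead j α) (Set.Icc 0 T)) ∧
  (∀ (j : ℕ) (α : Fin n → ℕ), j + ∑ i, α i ≤ 2 →
      AnalyticOnNhd ℝ (P.lower j α) (Set.Icc 0 T))

/-- Weak hyperbolicity on `[0,T]`: the cubic `L(t,·,ξ)` has three real roots
(counted with multiplicity). -/
def WeaklyHyperbolic (T : ℝ) : Prop :=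
  ∀ t ∈ Set.Icc 0 T, ∀ ξ : EuclideanSpace ℝ (Fin n), ∃ τ₁ τ₂ τ₃ : ℝ, τ₁ ≤ τ₂ ∧ τ₂ ≤ τ₃ ∧
    ∀ τ : ℝ, P.symL t τ ξ = (τ - τ₁) * (τ - τ₂) * (τ - τ₃)

/-- The integral Levi condition on the terms of order one:
`∫₀ᵀ ∑_{j=1,2} √(|Ň(t,μ_j,ξ)| / |μ₂ - μ₁|) dt ≲ log (1 + |ξ|)`, for `|ξ| ≥ 1`. -/
def IntegralLevi (T : ℝ) : Prop :=
  ∃ C : ℝ, 0 < C ∧ ∀ ξ : EuclideanSpace ℝ (Fin n), 1 ≤ ‖ξ‖ →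
    IntervalIntegrable (fun t : ℝ =>
        √(‖P.symNcheck t (P.μ₁ t ξ) ξ‖ / |P.μ₂ t ξ - P.μ₁ t ξ|)
          + √(‖P.symNcheck t (P.μ₂ t ξ) ξ‖ / |P.μ₂ t ξ - P.μ₁ t ξ|))
      MeasureTheory.volume 0 T ∧
    ∫ t in (0 : ℝ)..T,
        (√(‖P.symNcheck t (P.μ₁ t ξ) ξ‖ / |P.μ₂ t ξ - P.μ₁ t ξ|)
          + √(‖P.symNcheck t (P.μ₂ t ξ) ξ‖ / |P.μ₂ t ξ - P.μ₁ t ξ|))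
      ≤ C * Real.log (1 + ‖ξ‖)

/-- The pointwise condition `|Ň(t,σ_j,ξ)| ≲ √Δ + (∂ₜΔ)² / Δ^{3/2}`, `j = 1, 2`, at the points
where `Δ ≠ 0` (elsewhere the right-hand side is not defined). -/
def PointwiseLevi (T : ℝ) : Prop :=
  ∃ C : ℝ, 0 < C ∧ ∀ t ∈ Set.Icc 0 T, ∀ ξ : EuclideanSpace ℝ (Fin n), P.Δ t ξ ≠ 0 →
    ‖P.symNcheck t (P.σ₁ t ξ) ξ‖ ≤
        C * (√(P.Δ t ξ)
          + (derivWithin (fun s => P.Δ s ξ) (Set.Icc 0 T) t) ^ 2 / P.Δ t ξ ^ (3 / 2 : ℝ)) ∧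
    ‖P.symNcheck t (P.σ₂ t ξ) ξ‖ ≤
        C * (√(P.Δ t ξ)
          + (derivWithin (fun s => P.Δ s ξ) (Set.Icc 0 T) t) ^ 2 / P.Δ t ξ ^ (3 / 2 : ℝ))

/-- There are finitely many pairwise distinct points `t₁, …, t_ν` (the elements of `S`) with
`∏ⱼ (t - tⱼ)² |Ň(t,σ₁,ξ)| ≲ |σ₂ - σ₁|`. -/
def ProductLevi (T : ℝ) : Prop :=
  ∃ S : Finset ℝ, ∃ C : ℝ, 0 < C ∧
    ∀ t ∈ Set.Icc 0 T, ∀ ξ : EuclideanSpace ℝ (Fin n),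
      (∏ s ∈ S, (t - s) ^ 2) * ‖P.symNcheck t (P.σ₁ t ξ) ξ‖ ≤ C * |P.σ₂ t ξ - P.σ₁ t ξ|

/-! Under weak hyperbolicity `σ₁ ≤ σ₂` and `μ₁ < μ₂` really are the roots, with multiplicity, of
`∂_τ L` and `∂_τ 𝓛`. -/

theorem quadratic_roots {f : ℝ → ℝ} {b c : ℝ} (hf : ∀ x, f x = 3 * x ^ 2 + 2 * b * x + c)
    (h : 0 ≤ b ^ 2 - 3 * c) (x : ℝ) :
    f x = 3 * (x - sInf {y | f y = 0}) * (x - sSup {y | f y = 0}) ∧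
      sSup {y | f y = 0} - sInf {y | f y = 0} = 2 / 3 * √(b ^ 2 - 3 * c) := by
  set d := √(b ^ 2 - 3 * c) with hd
  have hd2 : d ^ 2 = b ^ 2 - 3 * c := Real.sq_sqrt h
  have hd0 : 0 ≤ d := Real.sqrt_nonneg _
  have hfac : ∀ y, f y = 3 * (y - (-b - d) / 3) * (y - (-b + d) / 3) := by
    intro y
    rw [hf y]
    linear_combination (1 / 3) * hd2
  have hset : {y | f y = 0} = {(-b - d) / 3, (-b + d) / 3} := by
    ext y
    simp only [Set.mem_ofPred_eq, Set.mem_insert_iff, Set.mem_singleton_iff, hfac y]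
    simp [sub_eq_zero]
  have hle : (-b - d) / 3 ≤ (-b + d) / 3 := by linarith
  rw [hset, csInf_pair, csSup_pair, inf_eq_left.2 hle, sup_eq_right.2 hle]
  exact ⟨hfac x, by ring⟩

theorem dL_of_factor {P : ThirdOrderOperator n} {t τ₁ τ₂ τ₃ : ℝ} {ξ : EuclideanSpace ℝ (Fin n)}
    (h : ∀ τ : ℝ, P.symL t τ ξ = (τ - τ₁) * (τ - τ₂) * (τ - τ₃)) (τ : ℝ) :
    P.dL t τ ξ = 3 * τ ^ 2 + 2 * (-(τ₁ + τ₂ + τ₃)) * τ + (τ₁ * τ₂ + τ₂ * τ₃ + τ₃ * τ₁) ∧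
    P.dLaux t τ ξ =
      3 * τ ^ 2 + 2 * (-(τ₁ + τ₂ + τ₃)) * τ + (τ₁ * τ₂ + τ₂ * τ₃ + τ₃ * τ₁ - 6) := by
  have e : (fun z : ℝ => P.symL t z ξ) = fun z => (z - τ₁) * (z - τ₂) * (z - τ₃) := funext h
  have d1 : ∀ z : ℝ, HasDerivAt (fun z : ℝ => (z - τ₁) * (z - τ₂) * (z - τ₃))
      (3 * z ^ 2 + 2 * (-(τ₁ + τ₂ + τ₃)) * z + (τ₁ * τ₂ + τ₂ * τ₃ + τ₃ * τ₁)) z := by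
    intro z
    have := (((hasDerivAt_id z).sub_const τ₁).mul ((hasDerivAt_id z).sub_const τ₂)).mul
      ((hasDerivAt_id z).sub_const τ₃)
    refine this.congr_deriv ?_
    simp only [id, Pi.mul_apply]
    ring
  have e1 : deriv (fun z : ℝ => P.symL t z ξ) = fun z =>
      3 * z ^ 2 + 2 * (-(τ₁ + τ₂ + τ₃)) * z + (τ₁ * τ₂ + τ₂ * τ₃ + τ₃ * τ₁) := by
    rw [e]
    exact funext fun z => (d1 z).deriv
  have d2 : ∀ z : ℝ, HasDerivAt (fun z : ℝ =>
      3 * z ^ 2 + 2 * (-(τ₁ + τ₂ + τ₃)) * z + (τ₁ * τ₂ + τ₂ * τ₃ + τ₃ * τ₁))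
      (6 * z + 2 * (-(τ₁ + τ₂ + τ₃))) z := by
    intro z
    have := (((hasDerivAt_pow 2 z).const_mul 3).add
      ((hasDerivAt_id z).const_mul (2 * (-(τ₁ + τ₂ + τ₃))))).add_const
        (τ₁ * τ₂ + τ₂ * τ₃ + τ₃ * τ₁)
    refine this.congr_deriv ?_
    norm_num
    ring
  refine ⟨congrFun e1 τ, ?_⟩
  have e2 : (fun z : ℝ => P.symLaux t z ξ) = fun z =>
      (z - τ₁) * (z - τ₂) * (z - τ₃) - (6 * z + 2 * (-(τ₁ + τ₂ + τ₃))) := by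
    funext z
    have : iteratedDeriv 2 (fun z : ℝ => P.symL t z ξ) z = 6 * z + 2 * (-(τ₁ + τ₂ + τ₃)) := by
      rw [iteratedDeriv_succ, iteratedDeriv_one, e1]
      exact (d2 z).deriv
    rw [symLaux, this, h z]
  rw [dLaux, e2]
  have := (d1 τ).sub (((hasDerivAt_id τ).const_mul 6).add_const (2 * (-(τ₁ + τ₂ + τ₃))))
  refine (this.congr_deriv ?_).deriv
  ring

theorem WeaklyHyperbolic.roots {P : ThirdOrderOperator n} {T : ℝ} (hP : P.WeaklyHyperbolic T)
    {t : ℝ} (ht : t ∈ Set.Icc 0 T) (ξ : EuclideanSpace ℝ (Fin n)) :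
    (∀ τ, P.dL t τ ξ = 3 * (τ - P.σ₁ t ξ) * (τ - P.σ₂ t ξ)) ∧ P.σ₁ t ξ ≤ P.σ₂ t ξ ∧
    (∀ τ, P.dLaux t τ ξ = 3 * (τ - P.μ₁ t ξ) * (τ - P.μ₂ t ξ)) ∧ P.μ₁ t ξ < P.μ₂ t ξ := by
  obtain ⟨τ₁, τ₂, τ₃, -, -, h⟩ := hP t ht ξ
  have hq : 0 ≤ (-(τ₁ + τ₂ + τ₃)) ^ 2 - 3 * (τ₁ * τ₂ + τ₂ * τ₃ + τ₃ * τ₁) := by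
    nlinarith [sq_nonneg (τ₁ - τ₂), sq_nonneg (τ₂ - τ₃), sq_nonneg (τ₃ - τ₁)]
  have hq' : 0 < (-(τ₁ + τ₂ + τ₃)) ^ 2 - 3 * (τ₁ * τ₂ + τ₂ * τ₃ + τ₃ * τ₁ - 6) := by linarith
  have A := quadratic_roots (fun τ => (dL_of_factor h τ).1) hq
  have B := quadratic_roots (fun τ => (dL_of_factor h τ).2) hq'.le
  refine ⟨fun τ => (A τ).1, ?_, fun τ => (B τ).1, ?_⟩
  · have := (A 0).2
    have h0 := Real.sqrt_nonneg
      ((-(τ₁ + τ₂ + τ₃)) ^ 2 - 3 * (τ₁ * τ₂ + τ₂ * τ₃ + τ₃ * τ₁))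
    simp only [σ₁, σ₂]
    linarith
  · have := (B 0).2
    have h0 := Real.sqrt_pos.2 hq'
    simp only [μ₁, μ₂]
    linarith

end ThirdOrderOperator

/-! The symbol `Ň` is affine in `τ`, and the pairs `σ₁, σ₂` and `μ₁, μ₂` have the same midpoint.
Write `mid` for the value of `Ň` there, a linear form in `ξ`, and `disc` for `Δ`, a nonnegative
quadratic form in `ξ`. Then `Ň` equals `mid ± slope * √disc / 2` at the `σ`'s and `mid ± slope *
√(disc + 8) / 2` at the `μ`'s. The `slope` terms are absorbed in each condition, so all three become
statements about `mid` and `disc` (`pointwiseLevi_iff`, `productLevi_iff`, `integralLevi_iff`).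

(A) implies (B): with `F = log (1 + disc ^ (1/4))`, the pointwise bound gives `√(|mid| / √(disc +
8)) ≤ √C + 8 √C |∂ₜF|` (`sqrt_div_sqrt_le`). The integral of `|∂ₜF|` is at most `sup F`, which is
`O(log (1 + |ξ|))`, times the number of intervals of monotonicity of `disc`. That number is bounded
uniformly in `ξ`, because `∂ₜ disc` is a linear combination of finitely many fixed analytic
functions (`exists_card_zeros_le`). Directions with `disc` identically zero are handled by
perturbing `ξ`, which forces `mid` to vanish (`mid_eq_zero_of_disc_eq_zero`).

For `n = 1`, `disc = ξ² q(t)` and `mid = ξ h(t)`, and only orders of vanishing matter. If `h` has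
order `m` and `q` order `k` at a point, (B) forces `k ≤ 2m + 4`: otherwise, for large `ξ`, a short
interval near that point contributes more than a logarithm (`local_bound_of_integral_bound`). This
is (C) with the zeros of `q` as the points `tⱼ`. Conversely `|q| ≤ 2 |t - x| |q'|` near a zero `x`
of `q`, so the loss `(t - x)⁻²` in (C) is paid for by `q'² / q²`, which is (A). -/

section Analysis

open Set Filter Topology MeasureTheory

/-! ### Zeros of linear combinations of analytic functions -/

theorem AnalyticOnNhd.eqOn_zero_of_frequently_Icc {E : Type*} [NormedAddCommGroup E]
    [NormedSpace ℝ E] {f : ℝ → E} {a b : ℝ} (hf : AnalyticOnNhd ℝ f (Icc a b))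
    {x : ℝ} (hx : x ∈ Icc a b) (h : ∃ᶠ z in 𝓝[≠] x, f z = 0) : ∀ t ∈ Icc a b, f t = 0 :=
  hf.eqOn_zero_of_preconnected_of_frequently_eq_zero isPreconnected_Icc hx h

theorem AnalyticOnNhd.finite_zeros_Icc {E : Type*} [NormedAddCommGroup E] [NormedSpace ℝ E]
    {f : ℝ → E} {a b : ℝ} (hf : AnalyticOnNhd ℝ f (Icc a b)) (hne : ∃ t ∈ Icc a b, f t ≠ 0) :
    {t | t ∈ Icc a b ∧ f t = 0}.Finite := by
  by_contra hinf
  obtain ⟨x, hx, hacc⟩ := Set.Infinite.exists_accPt_of_subset_isCompact hinf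
    (isCompact_Icc (a := a) (b := b)) (fun t ht => ht.1)
  obtain ⟨t, ht, hft⟩ := hne
  refine hft (hf.eqOn_zero_of_frequently_Icc hx ?_ t ht)
  exact (accPt_iff_frequently_nhdsNE.1 hacc).mono fun z hz => hz.2

/-- If the Wronskian of `f` and `g` vanishes on `[a, b]` and `f` has a zero where `g` does not
vanish, then `f` vanishes on `[a, b]`. -/
theorem eq_zero_of_wronskian_eq_zero {f g : ℝ → ℝ} {a b : ℝ} (hab : a < b)
    (hf : AnalyticOnNhd ℝ f (Icc a b)) (hg : AnalyticOnNhd ℝ g (Icc a b))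
    (hw : ∀ t ∈ Icc a b, deriv f t * g t - f t * deriv g t = 0)
    {x : ℝ} (hx : x ∈ Icc a b) (hfx : f x = 0) (hgx : g x ≠ 0) : ∀ t ∈ Icc a b, f t = 0 := by
  have hev : ∀ᶠ t in 𝓝 x, g t ≠ 0 := (hg x hx).continuousAt.eventually_ne hgx
  obtain ⟨ε, hε, hball⟩ := Metric.eventually_nhds_iff_ball.1 hev
  have hconv : Convex ℝ (Icc a b ∩ Metric.ball x ε) := (convex_Icc a b).inter (convex_ball x ε)
  have hder : ∀ t ∈ Icc a b ∩ Metric.ball x ε,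
      HasDerivWithinAt (fun s => f s / g s) 0 (Icc a b ∩ Metric.ball x ε) t := by
    intro t ht
    have h1 := ((hf t ht.1).differentiableAt.hasDerivAt.fun_div
      (hg t ht.1).differentiableAt.hasDerivAt (hball t ht.2))
    rw [hw t ht.1, zero_div] at h1
    exact h1.hasDerivWithinAt
  have hzero : ∀ t ∈ Icc a b ∩ Metric.ball x ε, f t = 0 := by
    intro t ht
    have := hconv.norm_image_sub_le_of_norm_hasDerivWithin_le (C := 0) hder (by simp)
      ⟨hx, Metric.mem_ball_self hε⟩ ht
    rw [hfx, zero_div, sub_zero, zero_mul] at this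
    have h2 := norm_le_zero_iff.1 this
    exact (div_eq_zero_iff.1 h2).resolve_right (hball t ht.2)
  refine hf.eqOn_zero_of_frequently_Icc hx ?_
  have hacc := ((uniqueDiffOn_Icc hab) x hx).accPt
  have hf1 := accPt_iff_frequently_nhdsNE.1 hacc
  have hb : ∀ᶠ t in 𝓝[≠] x, t ∈ Metric.ball x ε :=
    nhdsWithin_le_nhds (Metric.ball_mem_nhds x hε)
  exact (hf1.and_eventually hb).mono fun t ht => hzero t ht

/-- The number of zeros in `[a, b]` of a nontrivial linear combination of finitely many
analytic functions is bounded uniformly in the coefficients. -/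
theorem exists_card_zeros_le {ι : Type*} {a b : ℝ} (hab : a < b) (s : Finset ι) :
    ∀ q : ι → ℝ → ℝ, (∀ i ∈ s, AnalyticOnNhd ℝ (q i) (Icc a b)) → ∃ N : ℕ, ∀ c : ι → ℝ,
      (∀ t ∈ Icc a b, ∑ i ∈ s, c i * q i t = 0) ∨
      ∀ F : Finset ℝ, (∀ t ∈ F, t ∈ Icc a b ∧ ∑ i ∈ s, c i * q i t = 0) → F.card ≤ N := by
  classical
  induction s using Finset.induction_on with
  | empty => exact fun q _ => ⟨0, fun c => Or.inl (by simp)⟩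
  | insert i₀ s hi₀ ih =>
    intro q hq
    have hq0 : AnalyticOnNhd ℝ (q i₀) (Icc a b) := hq i₀ (Finset.mem_insert_self _ _)
    have hqs : ∀ i ∈ s, AnalyticOnNhd ℝ (q i) (Icc a b) :=
      fun i hi => hq i (Finset.mem_insert_of_mem hi)
    by_cases hzero : ∀ t ∈ Icc a b, q i₀ t = 0
    · obtain ⟨N, hN⟩ := ih q hqs
      refine ⟨N, fun c => ?_⟩
      have hsum : ∀ t ∈ Icc a b, ∑ i ∈ insert i₀ s, c i * q i t = ∑ i ∈ s, c i * q i t := by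
        intro t ht
        rw [Finset.sum_insert hi₀, hzero t ht, mul_zero, zero_add]
      refine (hN c).imp (fun h t ht => (hsum t ht).trans (h t ht)) fun h F hF => h F ?_
      exact fun t ht => ⟨(hF t ht).1, (hsum t (hF t ht).1) ▸ (hF t ht).2⟩
    · push Not at hzero
      have hZfin := hq0.finite_zeros_Icc hzero
      set Z := hZfin.toFinset with hZ
      -- Dividing the sum by `q i₀` and differentiating removes the `i₀` term. The numerator is a
      -- combination, with the same coefficients, of the Wronskians of the other `q i` with `q i₀`,
      -- so the induction hypothesis applies to it.
      obtain ⟨N, hN⟩ := ih (fun i t => deriv (q i) t * q i₀ t - q i t * deriv (q i₀) t)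
        (fun i hi => ((hqs i hi).deriv.mul hq0).sub ((hqs i hi).mul hq0.deriv))
      -- The first `Z.card` counts zeros lying in `Z`; those outside `Z` are separated by points of
      -- `Z` or by at most `N` zeros of the Wronskian, whence the `+ 1`.
      refine ⟨Z.card + (Z.card + N + 1), fun c => ?_⟩
      set f : ℝ → ℝ := fun t => ∑ i ∈ insert i₀ s, c i * q i t with hfdef
      have hfan : AnalyticOnNhd ℝ f (Icc a b) :=
        Finset.analyticOnNhd_fun_sum _ fun i hi => analyticOnNhd_const.mul (hq i hi)
      have hderf : ∀ t ∈ Icc a b, deriv f t = ∑ i ∈ insert i₀ s, c i * deriv (q i) t := by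
        intro t ht
        refine HasDerivAt.deriv (HasDerivAt.fun_sum fun i hi => ?_)
        exact (hq i hi t ht).differentiableAt.hasDerivAt.const_mul (c i)
      have hw : ∀ t ∈ Icc a b, deriv f t * q i₀ t - f t * deriv (q i₀) t =
          ∑ i ∈ s, c i * (deriv (q i) t * q i₀ t - q i t * deriv (q i₀) t) := by
        intro t ht
        rw [hderf t ht]
        simp only [hfdef, Finset.sum_insert hi₀, add_mul, Finset.sum_mul, mul_sub,
          Finset.sum_sub_distrib]
        ring_nf
      rcases hN c with h0 | hcard
      · by_cases hex : ∃ x ∈ Icc a b, f x = 0 ∧ q i₀ x ≠ 0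
        · obtain ⟨x, hx, hfx, hqx⟩ := hex
          exact Or.inl (eq_zero_of_wronskian_eq_zero hab hfan hq0
            (fun t ht => (hw t ht).trans (h0 t ht)) hx hfx hqx)
        · push Not at hex
          refine Or.inr fun F hF => (Finset.card_le_card (t := Z) fun t ht => ?_).trans (by omega)
          rw [hZ, Set.Finite.mem_toFinset]
          exact ⟨(hF t ht).1, hex t (hF t ht).1 (hF t ht).2⟩
      · refine Or.inr fun F hF => ?_
        have hWfin : {t | t ∈ Icc a b ∧
            ∑ i ∈ s, c i * (deriv (q i) t * q i₀ t - q i t * deriv (q i₀) t) = 0}.Finite := by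
          by_contra hinf
          obtain ⟨G, hG, hGc⟩ := Set.Infinite.exists_subset_card_eq hinf (N + 1)
          have := hcard G fun t ht => hG ht
          omega
        set W := hWfin.toFinset with hW
        have hWc : W.card ≤ N := hcard W fun t ht => by
          rwa [hW, Set.Finite.mem_toFinset] at ht
        -- Between two zeros outside `Z` there is either a zero of `q i₀` or, by Rolle applied to `f
        -- / q i₀`, a zero of the Wronskian.
        have hsd : (F \ Z).card ≤ (Z ∪ W).card + 1 := by
          refine Finset.card_le_of_interleaved fun x hx y hy hxy _ => ?_
          rw [Finset.mem_sdiff, hZ, Set.Finite.mem_toFinset] at hx hy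
          have hxI := (hF x hx.1).1
          have hyI := (hF y hy.1).1
          by_cases hz : ∃ z ∈ Z, x < z ∧ z < y
          · obtain ⟨z, hz, h⟩ := hz
            exact ⟨z, Finset.mem_union_left _ hz, h⟩
          · push Not at hz
            have hI : ∀ t ∈ Icc x y, t ∈ Icc a b := fun t ht =>
              ⟨hxI.1.trans ht.1, ht.2.trans hyI.2⟩
            have hne : ∀ t ∈ Icc x y, q i₀ t ≠ 0 := by
              intro t ht h
              rcases ht.1.eq_or_lt with rfl | h1
              · exact hx.2 ⟨hxI, h⟩
              rcases ht.2.eq_or_lt with rfl | h2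
              · exact hy.2 ⟨hyI, h⟩
              have := hz t (by rw [hZ, Set.Finite.mem_toFinset]; exact ⟨hI t ht, h⟩) h1
              linarith
            have hder : ∀ t ∈ Icc x y, HasDerivAt (fun s => f s / q i₀ s)
                ((deriv f t * q i₀ t - f t * deriv (q i₀) t) / q i₀ t ^ 2) t := fun t ht =>
              (hfan t (hI t ht)).differentiableAt.hasDerivAt.fun_div
                (hq0 t (hI t ht)).differentiableAt.hasDerivAt (hne t ht)
            obtain ⟨z, hzI, hz0⟩ := exists_hasDerivAt_eq_zero hxy
              (fun t ht => (hder t ht).continuousAt.continuousWithinAt)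
              (by simp only [hfdef]; rw [(hF x hx.1).2, (hF y hy.1).2, zero_div, zero_div])
              (fun t ht => hder t (Ioo_subset_Icc_self ht))
            have hzI' := Ioo_subset_Icc_self hzI
            refine ⟨z, Finset.mem_union_right _ ?_, hzI⟩
            rw [hW, Set.Finite.mem_toFinset]
            refine ⟨hI z hzI', ?_⟩
            rw [← hw z (hI z hzI')]
            exact (div_eq_zero_iff.1 hz0).resolve_right (pow_ne_zero 2 (hne z hzI'))
        have h1 := Finset.card_union_le Z W
        have h2 : F.card ≤ (F \ Z).card + Z.card := by
          have := Finset.le_card_sdiff Z F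
          omega
        omega

/-! ### Integrals controlled by total variation -/

/-- If `w ≤ C + K |F'|` away from a finite set, where `F'` does not vanish there and
`0 ≤ F ≤ B`, then the integral of `w` is controlled by the number of exceptional points. -/
theorem integral_le_of_le_abs_deriv {F F' w : ℝ → ℝ} {B C K : ℝ} (hK : 0 ≤ K) (S : Finset ℝ)
    (k : ℕ) : ∀ {a b : ℝ}, a ≤ b → (S.filter fun t => t ∈ Ioo a b).card ≤ k →
    ContinuousOn F (Icc a b) → ContinuousOn w (Icc a b) →
    (∀ t ∈ Icc a b, 0 ≤ F t ∧ F t ≤ B) →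
    (∀ t ∈ Ioo a b, t ∉ S → HasDerivAt F (F' t) t ∧ F' t ≠ 0 ∧ w t ≤ C + K * |F' t|) →
    ∫ t in a..b, w t ≤ C * (b - a) + (k + 1) * (K * B) := by
  induction k using Nat.strong_induction_on with
  | _ k ih =>
  intro a b hab hcard hF hw hB hder
  have hB0 : 0 ≤ B := (hB a (left_mem_Icc.2 hab)).1.trans (hB a (left_mem_Icc.2 hab)).2
  -- Cutting at an exceptional point `s` leaves halves with `k₁` and `k₂` such points and `k₁ + k₂ +
  -- 1 ≤ k`, so `(k₁ + 1) + (k₂ + 1) ≤ k + 1`.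
  by_cases hS : ∃ s ∈ S, s ∈ Ioo a b
  · obtain ⟨s, hs, hsI⟩ := hS
    have hsub1 : Icc a s ⊆ Icc a b := Icc_subset_Icc_right hsI.2.le
    have hsub2 : Icc s b ⊆ Icc a b := Icc_subset_Icc_left hsI.1.le
    have hc : (S.filter fun t => t ∈ Ioo a s).card + (S.filter fun t => t ∈ Ioo s b).card + 1 ≤
        (S.filter fun t => t ∈ Ioo a b).card := by
      have hd : Disjoint (S.filter fun t => t ∈ Ioo a s) (S.filter fun t => t ∈ Ioo s b) := by
        rw [Finset.disjoint_left]
        intro t h1 h2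
        have h1 := (Finset.mem_filter.1 h1).2.2
        have h2 := (Finset.mem_filter.1 h2).2.1
        linarith
      rw [← Finset.card_union_of_disjoint hd]
      have hsn : s ∉ (S.filter fun t => t ∈ Ioo a s) ∪ (S.filter fun t => t ∈ Ioo s b) := by
        simp
      rw [← Finset.card_insert_of_notMem hsn]
      refine Finset.card_le_card fun t ht => ?_
      simp only [Finset.mem_insert, Finset.mem_union, Finset.mem_filter, mem_Ioo] at ht ⊢
      rcases ht with rfl | ⟨h, h1, h2⟩ | ⟨h, h1, h2⟩
      · exact ⟨hs, hsI⟩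
      · exact ⟨h, h1, h2.trans hsI.2⟩
      · exact ⟨h, hsI.1.trans h1, h2⟩
    have I1 := ih _ (by omega) hsI.1.le le_rfl (hF.mono hsub1) (hw.mono hsub1)
      (fun t ht => hB t (hsub1 ht)) (fun t ht => hder t ⟨ht.1, ht.2.trans hsI.2⟩)
    have I2 := ih _ (by omega) hsI.2.le le_rfl (hF.mono hsub2) (hw.mono hsub2)
      (fun t ht => hB t (hsub2 ht)) (fun t ht => hder t ⟨hsI.1.trans ht.1, ht.2⟩)
    rw [← intervalIntegral.integral_add_adjacent_intervals
      ((hw.mono hsub1).intervalIntegrable_of_Icc hsI.1.le)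
      ((hw.mono hsub2).intervalIntegrable_of_Icc hsI.2.le)]
    have hc' : ((S.filter fun t => t ∈ Ioo a s).card : ℝ) +
        (S.filter fun t => t ∈ Ioo s b).card + 1 ≤ k := by
      exact_mod_cast hc.trans hcard
    nlinarith [mul_le_mul_of_nonneg_right hc' (mul_nonneg hK hB0)]
  · push Not at hS
    have hder' : ∀ t ∈ Ioo a b, HasDerivAt F (F' t) t ∧ F' t ≠ 0 ∧ w t ≤ C + K * |F' t| :=
      fun t ht => hder t ht fun h => hS t h ht
    -- `F'` is not assumed integrable; once its sign is fixed, integrability follows from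
    -- nonnegativity of `G' = ±F'`.
    have key : ∀ G G' : ℝ → ℝ, ContinuousOn G (Icc a b) → (∀ t ∈ Ioo a b, HasDerivAt G (G' t) t) →
        (∀ t ∈ Ioo a b, 0 ≤ G' t) → (∀ t ∈ Ioo a b, w t ≤ C + K * G' t) →
        ∫ t in a..b, w t ≤ C * (b - a) + K * (G b - G a) := by
      intro G G' hG hG' hpos hle
      have hint : IntervalIntegrable G' volume a b := by
        rw [intervalIntegrable_iff_integrableOn_Ioc_of_le hab]
        exact intervalIntegral.integrableOn_deriv_of_nonneg hG hG' hpos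
      have h1 := intervalIntegral.integral_eq_sub_of_hasDerivAt_of_le hab hG hG' hint
      calc ∫ t in a..b, w t ≤ ∫ t in a..b, (C + K * G' t) :=
            intervalIntegral.integral_mono_on_of_le_Ioo hab (hw.intervalIntegrable_of_Icc hab)
              (intervalIntegrable_const.add (hint.const_mul K)) hle
        _ = C * (b - a) + K * (G b - G a) := by
            rw [intervalIntegral.integral_add intervalIntegrable_const (hint.const_mul K),
              intervalIntegral.integral_const_mul, h1, intervalIntegral.integral_const, smul_eq_mul,
              mul_comm C]
    have hBa := hB a (left_mem_Icc.2 hab)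
    have hBb := hB b (right_mem_Icc.2 hab)
    have hkK : 0 ≤ (k : ℝ) * (K * B) := by positivity
    -- By Darboux a derivative without zeros has constant sign, so `F` is monotone and its variation
    -- is at most `B`.
    rcases hasDerivWithinAt_forall_lt_or_forall_gt_of_forall_ne (convex_Ioo a b)
      (fun t ht => (hder' t ht).1.hasDerivWithinAt) (fun t ht => (hder' t ht).2.1) with hneg | hpos
    · have := key (fun t => -F t) (fun t => -F' t) hF.neg (fun t ht => (hder' t ht).1.neg)
        (fun t ht => by linarith [hneg t ht]) fun t ht => by
          rw [← abs_of_neg (hneg t ht)]; exact (hder' t ht).2.2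
      nlinarith
    · have := key F F' hF (fun t ht => (hder' t ht).1) (fun t ht => (hpos t ht).le) fun t ht => by
          have := (hder' t ht).2.2
          rwa [abs_of_pos (hpos t ht)] at this
      nlinarith

end Analysis

/-! ### The symbols as explicit polynomials in `τ` and `ξ` -/

namespace ThirdOrderOperator

open Set Filter Topology

variable {n : ℕ} (P : ThirdOrderOperator n)

theorem exists_monom_succ {α : Fin n → ℕ} {k : ℕ} (hα : ∑ i, α i = k + 1) :
    ∃ (i : Fin n) (β : Fin n → ℕ), ∑ j, β j = k ∧ ∀ ξ, monom ξ α = ξ i * monom ξ β := by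
  obtain ⟨i, -, hi⟩ : ∃ i ∈ Finset.univ, α i ≠ 0 := by
    by_contra! h
    rw [Finset.sum_eq_zero h] at hα
    omega
  refine ⟨i, Function.update α i (α i - 1), ?_, fun ξ => ?_⟩
  · rw [Finset.sum_update_of_mem (Finset.mem_univ i)]
    rw [← Finset.add_sum_erase _ _ (Finset.mem_univ i), Finset.erase_eq] at hα
    omega
  · have h1 : ∀ j ∈ Finset.univ.erase i, ξ j ^ Function.update α i (α i - 1) j = ξ j ^ α j := by
      intro j hj
      rw [Function.update_of_ne (Finset.ne_of_mem_erase hj)]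
    rw [monom, monom, ← Finset.mul_prod_erase _ _ (Finset.mem_univ i),
      ← Finset.mul_prod_erase _ (fun j => ξ j ^ Function.update α i (α i - 1) j)
        (Finset.mem_univ i), Finset.prod_congr rfl h1, Function.update_self, ← mul_assoc,
      ← pow_succ', Nat.sub_add_cancel (Nat.pos_of_ne_zero hi)]

theorem monom_of_sum_eq_zero {α : Fin n → ℕ} (hα : ∑ i, α i = 0)
    (ξ : EuclideanSpace ℝ (Fin n)) : monom ξ α = 1 := by
  have h : ∀ i, α i = 0 := fun i => (Finset.sum_eq_zero_iff.1 hα) i (Finset.mem_univ i)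
  simp [monom, h]

theorem exists_monom_eq {α : Fin n → ℕ} (hα : ∑ i, α i = 1) :
    ∃ i : Fin n, ∀ ξ, monom ξ α = ξ i := by
  obtain ⟨i, β, hβ, h⟩ := exists_monom_succ hα
  exact ⟨i, fun ξ => by rw [h, monom_of_sum_eq_zero hβ, mul_one]⟩

theorem exists_monom_eq_mul {α : Fin n → ℕ} (hα : ∑ i, α i = 2) :
    ∃ i j : Fin n, ∀ ξ, monom ξ α = ξ i * ξ j := by
  obtain ⟨i, β, hβ, h⟩ := exists_monom_succ hα
  obtain ⟨j, hj⟩ := exists_monom_eq hβ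
  exact ⟨i, j, fun ξ => by rw [h, hj]⟩

/-- The multi-indices of length `k`. -/
abbrev multiIdx (n k : ℕ) : Finset (Fin n → ℕ) := Finset.piAntidiag Finset.univ k

theorem sum_eq_of_mem_multiIdx {k : ℕ} {α : Fin n → ℕ} (hα : α ∈ multiIdx n k) :
    ∑ i, α i = k := (Finset.mem_piAntidiag.1 hα).1

/-- The coefficient of `τ²` in `L`. -/
noncomputable def coeffA (t : ℝ) (ξ : EuclideanSpace ℝ (Fin n)) : ℝ :=
  ∑ α ∈ multiIdx n 1, P.lead 2 α t * monom ξ α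

/-- The coefficient of `τ` in `L`. -/
noncomputable def coeffB (t : ℝ) (ξ : EuclideanSpace ℝ (Fin n)) : ℝ :=
  ∑ α ∈ multiIdx n 2, P.lead 1 α t * monom ξ α

/-- The coefficient of `τ⁰` in `L`. -/
noncomputable def coeffD (t : ℝ) (ξ : EuclideanSpace ℝ (Fin n)) : ℝ :=
  ∑ α ∈ multiIdx n 3, P.lead 0 α t * monom ξ α

/-- The discriminant of `∂_τ L / 3`, as a quadratic form in `ξ`. -/
noncomputable def disc (t : ℝ) (ξ : EuclideanSpace ℝ (Fin n)) : ℝ :=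
  4 / 9 * (P.coeffA t ξ ^ 2 - 3 * P.coeffB t ξ)

/-- The coefficient of `τ` in `Ň`. -/
noncomputable def slope (t : ℝ) : ℂ := P.lower 1 0 t - deriv (P.lower 2 0) t

/-- The coefficients of the linear form `Ň(t, (σ₁ + σ₂) / 2, ·)`. -/
noncomputable def midCoeff (α : Fin n → ℕ) (t : ℝ) : ℂ :=
  P.lower 0 α t - 1 / 2 * deriv (P.lower 1 α) t + 1 / 6 * ((deriv (deriv (P.lead 2 α)) t : ℝ) : ℂ)
    - 1 / 3 * P.slope t * (P.lead 2 α t : ℂ)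

/-- The linear form `Ň(t, (σ₁ + σ₂) / 2, ·)`. -/
noncomputable def mid (t : ℝ) (ξ : EuclideanSpace ℝ (Fin n)) : ℂ :=
  ∑ α ∈ multiIdx n 1, P.midCoeff α t * (monom ξ α : ℂ)

theorem symL_eq (t τ : ℝ) (ξ : EuclideanSpace ℝ (Fin n)) :
    P.symL t τ ξ = τ ^ 3 + P.coeffA t ξ * τ ^ 2 + P.coeffB t ξ * τ + P.coeffD t ξ := by
  simp only [symL, Finset.sum_range_succ, Finset.sum_range_zero, coeffA, coeffB, coeffD,
    Finset.sum_mul, Nat.reduceSub, Nat.sub_zero, zero_add, pow_zero, mul_one, pow_one]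
  simp only [mul_right_comm]
  ring

theorem symM_eq (t τ : ℝ) (ξ : EuclideanSpace ℝ (Fin n)) :
    P.symM t τ ξ = P.lower 2 0 t * (τ : ℂ) ^ 2 +
      (∑ α ∈ multiIdx n 1, P.lower 1 α t * (monom ξ α : ℂ)) * τ +
      ∑ α ∈ multiIdx n 2, P.lower 0 α t * (monom ξ α : ℂ) := by
  have h0 : monom ξ (0 : Fin n → ℕ) = 1 := monom_of_sum_eq_zero (by simp) ξ
  simp only [symM, Finset.sum_range_succ, Finset.sum_range_zero, Finset.sum_mul, Nat.sub_self,
    Nat.reduceSub, Nat.sub_zero, zero_add, pow_zero, mul_one, pow_one, Finset.piAntidiag_zero,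
    Finset.sum_singleton, h0, Complex.ofReal_one]
  simp only [mul_right_comm]
  ring

theorem symN_eq (t τ : ℝ) (ξ : EuclideanSpace ℝ (Fin n)) :
    P.symN t τ ξ = P.lower 1 0 t * (τ : ℂ) +
      ∑ α ∈ multiIdx n 1, P.lower 0 α t * (monom ξ α : ℂ) := by
  have h0 : monom ξ (0 : Fin n → ℕ) = 1 := monom_of_sum_eq_zero (by simp) ξ
  simp only [symN, Finset.sum_range_succ, Finset.sum_range_zero, Nat.sub_self,
    Nat.sub_zero, zero_add, pow_zero, mul_one, pow_one, Finset.piAntidiag_zero,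
    Finset.sum_singleton, h0, Complex.ofReal_one]
  ring

theorem deriv_symM (t τ : ℝ) (ξ : EuclideanSpace ℝ (Fin n)) :
    deriv (fun z : ℝ => P.symM t z ξ) τ = 2 * P.lower 2 0 t * (τ : ℂ) +
      ∑ α ∈ multiIdx n 1, P.lower 1 α t * (monom ξ α : ℂ) := by
  simp only [symM_eq]
  have h1 : HasDerivAt (fun z : ℝ => (z : ℂ)) 1 τ := Complex.ofRealCLM.hasDerivAt
  refine ((((h1.fun_pow 2).const_mul _).add (h1.const_mul _)).add_const _).deriv.trans ?_
  push_cast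
  ring

theorem iteratedDeriv_symL (t τ : ℝ) (ξ : EuclideanSpace ℝ (Fin n)) :
    iteratedDeriv 2 (fun z : ℝ => P.symL t z ξ) τ = 6 * τ + 2 * P.coeffA t ξ := by
  have h1 : ∀ z, HasDerivAt (fun z : ℝ => P.symL t z ξ)
      (3 * z ^ 2 + P.coeffA t ξ * (2 * z) + P.coeffB t ξ) z := by
    intro z
    simp only [symL_eq]
    refine (((((hasDerivAt_pow 3 z).add ((hasDerivAt_pow 2 z).const_mul _)).add
      ((hasDerivAt_id z).const_mul _)).add_const _)).congr_deriv ?_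
    norm_num
  rw [iteratedDeriv_succ, iteratedDeriv_one, funext fun z => (h1 z).deriv]
  refine ((((hasDerivAt_pow 2 τ).const_mul 3).add
    (((hasDerivAt_id τ).const_mul 2).const_mul (P.coeffA t ξ))).add_const
      (P.coeffB t ξ)).deriv.trans ?_
  norm_num
  ring

variable {P} {T : ℝ}

theorem AnalyticCoefficients.lead_mem (h : P.AnalyticCoefficients T) {j k : ℕ} (hj : j < 3)
    (hjk : j + k = 3) {α : Fin n → ℕ} (hα : α ∈ multiIdx n k) :
    AnalyticOnNhd ℝ (P.lead j α) (Icc 0 T) :=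
  h.1 j α hj (by rw [sum_eq_of_mem_multiIdx hα, hjk])

theorem AnalyticCoefficients.lower_mem (h : P.AnalyticCoefficients T) {j k : ℕ}
    (hjk : j + k ≤ 2) {α : Fin n → ℕ} (hα : α ∈ multiIdx n k) :
    AnalyticOnNhd ℝ (P.lower j α) (Icc 0 T) :=
  h.2 j α (by rwa [sum_eq_of_mem_multiIdx hα])

theorem zero_mem_multiIdx : (0 : Fin n → ℕ) ∈ multiIdx n 0 := by
  simp [multiIdx]

theorem AnalyticCoefficients.slope (h : P.AnalyticCoefficients T) :
    AnalyticOnNhd ℝ P.slope (Icc 0 T) :=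
  (h.lower_mem (by norm_num) zero_mem_multiIdx).sub
    (h.lower_mem (by norm_num) zero_mem_multiIdx).deriv

theorem AnalyticCoefficients.midCoeff (h : P.AnalyticCoefficients T) {α : Fin n → ℕ}
    (hα : α ∈ multiIdx n 1) : AnalyticOnNhd ℝ (P.midCoeff α) (Icc 0 T) := by
  have hl := h.lead_mem (j := 2) (by norm_num) (by norm_num) hα
  have hof : ∀ {f : ℝ → ℝ}, AnalyticOnNhd ℝ f (Icc 0 T) →
      AnalyticOnNhd ℝ (fun t => (f t : ℂ)) (Icc 0 T) := fun hf t ht =>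
    (Complex.ofRealCLM.analyticAt _).comp (hf t ht)
  exact (((h.lower_mem (by norm_num) hα).sub
    (analyticOnNhd_const.mul (h.lower_mem (by norm_num) hα).deriv)).add
      (analyticOnNhd_const.mul (hof hl.deriv.deriv))).sub
        ((analyticOnNhd_const.mul h.slope).mul (hof hl))

theorem AnalyticCoefficients.iteratedDeriv_coeffA (h : P.AnalyticCoefficients T) {t : ℝ}
    (ht : t ∈ Icc 0 T) (τ : ℝ) (ξ : EuclideanSpace ℝ (Fin n)) :
    iteratedDeriv 2 (fun s => 6 * τ + 2 * P.coeffA s ξ) t =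
      2 * ∑ α ∈ multiIdx n 1, deriv (deriv (P.lead 2 α)) t * monom ξ α := by
  have hl : ∀ α ∈ multiIdx n 1, AnalyticAt ℝ (P.lead 2 α) t := fun α hα =>
    h.lead_mem (j := 2) (by norm_num) (by norm_num) hα t ht
  -- The formula for the first derivative is needed on a full neighbourhood of `t`, also when `t` is
  -- an endpoint.
  have hev : ∀ᶠ s in 𝓝 t, ∀ α ∈ multiIdx n 1, AnalyticAt ℝ (P.lead 2 α) s :=
    (Filter.eventually_all_finset _).2 fun α hα => (hl α hα).eventually_analyticAt
  have h1 : deriv (fun s => 6 * τ + 2 * P.coeffA s ξ) =ᶠ[𝓝 t]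
      fun s => 2 * ∑ α ∈ multiIdx n 1, deriv (P.lead 2 α) s * monom ξ α := by
    filter_upwards [hev] with s hs
    refine ((HasDerivAt.fun_sum fun α hα => ?_).const_mul 2).const_add _ |>.deriv
    exact (hs α hα).differentiableAt.hasDerivAt.mul_const _
  rw [iteratedDeriv_succ, iteratedDeriv_one, h1.deriv_eq]
  refine ((HasDerivAt.fun_sum fun α hα => ?_).const_mul 2).deriv
  exact (hl α hα).deriv.differentiableAt.hasDerivAt.mul_const _

/-- Expanding `Ň`, which is affine in `τ`, about `-coeffA / 3`, the common midpoint of the `σ`'s and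
of the `μ`'s, isolates the part that matters from a part proportional to the distance to the
midpoint. -/
theorem AnalyticCoefficients.symNcheck_eq (h : P.AnalyticCoefficients T) {t : ℝ}
    (ht : t ∈ Icc 0 T) (τ : ℝ) (ξ : EuclideanSpace ℝ (Fin n)) :
    P.symNcheck t τ ξ = P.mid t ξ + P.slope t * (τ + P.coeffA t ξ / 3 : ℝ) := by
  have hM : deriv (fun s : ℝ => deriv (fun z : ℝ => P.symM s z ξ) τ) t =
      2 * deriv (P.lower 2 0) t * (τ : ℂ) +
        ∑ α ∈ multiIdx n 1, deriv (P.lower 1 α) t * (monom ξ α : ℂ) := by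
    simp only [deriv_symM]
    refine HasDerivAt.deriv (HasDerivAt.add ?_ (HasDerivAt.fun_sum fun α hα => ?_))
    · exact (((h.lower_mem (by norm_num) zero_mem_multiIdx) t
        ht).differentiableAt.hasDerivAt.const_mul 2).mul_const _
    · exact ((h.lower_mem (by norm_num) hα) t ht).differentiableAt.hasDerivAt.mul_const _
  rw [symNcheck, hM, symN_eq]
  simp only [iteratedDeriv_symL]
  rw [h.iteratedDeriv_coeffA ht, mid]
  simp only [ThirdOrderOperator.midCoeff, coeffA, ThirdOrderOperator.slope]
  push_cast
  simp only [sub_mul, add_mul, Finset.sum_sub_distrib, Finset.sum_add_distrib, mul_assoc,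
    ← Finset.mul_sum]
  ring

/-- `Δ(t, ·)` is a quadratic form with coefficients analytic in `t`. -/
theorem AnalyticCoefficients.exists_disc_eq (h : P.AnalyticCoefficients T) :
    ∃ (ι : Type) (_ : Fintype ι) (k l : ι → Fin n) (q : ι → ℝ → ℝ),
      (∀ i, AnalyticOnNhd ℝ (q i) (Icc 0 T)) ∧
      ∀ t ξ, P.disc t ξ = ∑ i, ξ (k i) * ξ (l i) * q i t := by
  choose k hk using fun α : multiIdx n 1 => exists_monom_eq (sum_eq_of_mem_multiIdx α.2)
  choose i j hij using fun α : multiIdx n 2 => exists_monom_eq_mul (sum_eq_of_mem_multiIdx α.2)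
  refine ⟨(multiIdx n 1 × multiIdx n 1) ⊕ multiIdx n 2, inferInstance,
    Sum.elim (fun p => k p.1) i, Sum.elim (fun p => k p.2) j,
    Sum.elim (fun p t => 4 / 9 * (P.lead 2 p.1 t * P.lead 2 p.2 t))
      (fun α t => -(4 / 3) * P.lead 1 α t), ?_, fun t ξ => ?_⟩
  · rintro (⟨α, β⟩ | α)
    · exact analyticOnNhd_const.mul ((h.lead_mem (by norm_num) (by norm_num) α.2).mul
        (h.lead_mem (by norm_num) (by norm_num) β.2))
    · exact analyticOnNhd_const.mul (h.lead_mem (by norm_num) (by norm_num) α.2)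
  · have hA : P.coeffA t ξ = ∑ α : multiIdx n 1, P.lead 2 α t * ξ (k α) := by
      simp only [coeffA, ← hk]
      exact (Finset.sum_coe_sort _ _).symm
    have hB : P.coeffB t ξ = ∑ α : multiIdx n 2, P.lead 1 α t * (ξ (i α) * ξ (j α)) := by
      simp only [coeffB, ← hij]
      exact (Finset.sum_coe_sort _ _).symm
    rw [disc, hA, hB, Fintype.sum_sum_type, Fintype.sum_prod_type, sq, Finset.sum_mul_sum]
    simp only [Sum.elim_inl, Sum.elim_inr, mul_sub, Finset.mul_sum]
    rw [sub_eq_add_neg, ← Finset.sum_neg_distrib]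
    congr 1
    · exact Finset.sum_congr rfl fun α _ => Finset.sum_congr rfl fun β _ => by ring
    · exact Finset.sum_congr rfl fun α _ => by ring

theorem AnalyticCoefficients.exists_mid_eq (h : P.AnalyticCoefficients T) :
    ∃ (ι : Type) (_ : Fintype ι) (k : ι → Fin n) (g : ι → ℝ → ℂ),
      (∀ i, AnalyticOnNhd ℝ (g i) (Icc 0 T)) ∧
      ∀ t ξ, P.mid t ξ = ∑ i, (ξ (k i) : ℂ) * g i t := by
  choose k hk using fun α : multiIdx n 1 => exists_monom_eq (sum_eq_of_mem_multiIdx α.2)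
  refine ⟨multiIdx n 1, inferInstance, k, fun α => P.midCoeff α, fun α => h.midCoeff α.2,
    fun t ξ => ?_⟩
  simp only [mid, ← hk, mul_comm (_ : ℂ) (P.midCoeff _ _)]
  exact (Finset.sum_coe_sort _ _).symm

/-- Since `∂_τ 𝓛 = ∂_τ L - 6`, both quadratics have the same centre, and the squared gap of the
roots grows by `4/9 * 18 = 8`. -/
theorem WeaklyHyperbolic.disc_spec (hP : P.WeaklyHyperbolic T) {t : ℝ} (ht : t ∈ Icc 0 T)
    (ξ : EuclideanSpace ℝ (Fin n)) :
    0 ≤ P.disc t ξ ∧ P.Δ t ξ = P.disc t ξ ∧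
      P.σ₁ t ξ = -P.coeffA t ξ / 3 - √(P.disc t ξ) / 2 ∧
      P.σ₂ t ξ = -P.coeffA t ξ / 3 + √(P.disc t ξ) / 2 ∧
      P.μ₁ t ξ = -P.coeffA t ξ / 3 - √(P.disc t ξ + 8) / 2 ∧
      P.μ₂ t ξ = -P.coeffA t ξ / 3 + √(P.disc t ξ + 8) / 2 := by
  obtain ⟨τ₁, τ₂, τ₃, -, -, h⟩ := hP t ht ξ
  have e0 := h 0
  have e1 := h 1
  have e2 := h (-1)
  rw [symL_eq] at e0 e1 e2
  have hA : -(τ₁ + τ₂ + τ₃) = P.coeffA t ξ := by linarith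
  have hB : τ₁ * τ₂ + τ₂ * τ₃ + τ₃ * τ₁ = P.coeffB t ξ := by linarith
  have hd : P.disc t ξ = 4 / 9 * (P.coeffA t ξ ^ 2 - 3 * P.coeffB t ξ) := rfl
  have hq : 0 ≤ P.coeffA t ξ ^ 2 - 3 * P.coeffB t ξ := by
    rw [← hA, ← hB]
    nlinarith [sq_nonneg (τ₁ - τ₂), sq_nonneg (τ₂ - τ₃), sq_nonneg (τ₃ - τ₁)]
  have hdL := fun τ => (dL_of_factor h τ).1
  have hdX := fun τ => (dL_of_factor h τ).2
  rw [hA, hB] at hdL hdX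
  have key : ∀ (f : ℝ → ℝ) (b c : ℝ), (∀ x, f x = 3 * x ^ 2 + 2 * b * x + c) →
      0 ≤ b ^ 2 - 3 * c → sInf {y | f y = 0} = -b / 3 - √(4 / 9 * (b ^ 2 - 3 * c)) / 2 ∧
        sSup {y | f y = 0} = -b / 3 + √(4 / 9 * (b ^ 2 - 3 * c)) / 2 := by
    intro f b c hf hc
    have q0 := quadratic_roots hf hc 0
    have q1 := (quadratic_roots hf hc 1).1
    have q2 := (quadratic_roots hf hc (-1)).1
    rw [hf] at q1 q2
    have hs : √(4 / 9 * (b ^ 2 - 3 * c)) = 2 / 3 * √(b ^ 2 - 3 * c) := by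
      rw [Real.sqrt_mul (by norm_num), show (4 / 9 : ℝ) = (2 / 3) ^ 2 by norm_num,
        Real.sqrt_sq (by norm_num)]
    rw [hs]
    constructor <;> linarith [q0.2]
  obtain ⟨k1, k2⟩ := key _ _ _ hdL hq
  obtain ⟨k3, k4⟩ := key _ _ _ hdX (by linarith)
  have h8 : 4 / 9 * (P.coeffA t ξ ^ 2 - 3 * (P.coeffB t ξ - 6)) = P.disc t ξ + 8 := by
    rw [hd]; ring
  rw [h8] at k3 k4
  rw [← hd] at k1 k2
  have hd0 : 0 ≤ P.disc t ξ := by rw [hd]; linarith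
  refine ⟨hd0, ?_, k1, k2, k3, k4⟩
  rw [Δ, σ₁, σ₂, k1, k2]
  ring_nf
  rw [Real.sq_sqrt hd0]

end ThirdOrderOperator

/-! ### Reduction of the three conditions to `mid` and `disc` -/

namespace ThirdOrderOperator

open Set Filter Topology MeasureTheory

variable {n : ℕ} {P : ThirdOrderOperator n} {T : ℝ}

theorem AnalyticCoefficients.disc_analytic (h : P.AnalyticCoefficients T)
    (ξ : EuclideanSpace ℝ (Fin n)) : AnalyticOnNhd ℝ (fun t => P.disc t ξ) (Icc 0 T) := by
  obtain ⟨ι, _, k, l, q, hq, hd⟩ := h.exists_disc_eq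
  simp only [hd]
  exact Finset.analyticOnNhd_fun_sum _ fun i _ => analyticOnNhd_const.mul (hq i)

theorem AnalyticCoefficients.mid_analytic (h : P.AnalyticCoefficients T)
    (ξ : EuclideanSpace ℝ (Fin n)) : AnalyticOnNhd ℝ (fun t => P.mid t ξ) (Icc 0 T) := by
  obtain ⟨ι, _, k, g, hg, hm⟩ := h.exists_mid_eq
  simp only [hm]
  exact Finset.analyticOnNhd_fun_sum _ fun i _ => analyticOnNhd_const.mul (hg i)

theorem AnalyticCoefficients.disc_smul (h : P.AnalyticCoefficients T) (t c : ℝ)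
    (ξ : EuclideanSpace ℝ (Fin n)) : P.disc t (c • ξ) = c ^ 2 * P.disc t ξ := by
  obtain ⟨ι, _, k, l, q, -, hd⟩ := h.exists_disc_eq
  simp only [hd, PiLp.smul_apply, smul_eq_mul, Finset.mul_sum]
  exact Finset.sum_congr rfl fun i _ => by ring

theorem AnalyticCoefficients.mid_smul (h : P.AnalyticCoefficients T) (t c : ℝ)
    (ξ : EuclideanSpace ℝ (Fin n)) : P.mid t (c • ξ) = c * P.mid t ξ := by
  obtain ⟨ι, _, k, g, -, hm⟩ := h.exists_mid_eq
  simp only [hm, PiLp.smul_apply, smul_eq_mul, Finset.mul_sum, Complex.ofReal_mul]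
  exact Finset.sum_congr rfl fun i _ => by ring

theorem AnalyticCoefficients.mid_add (h : P.AnalyticCoefficients T) (t : ℝ)
    (ξ η : EuclideanSpace ℝ (Fin n)) : P.mid t (ξ + η) = P.mid t ξ + P.mid t η := by
  obtain ⟨ι, _, k, g, -, hm⟩ := h.exists_mid_eq
  simp only [hm, PiLp.add_apply, Complex.ofReal_add, add_mul, Finset.sum_add_distrib]

theorem AnalyticCoefficients.exists_disc_add_smul (h : P.AnalyticCoefficients T) (t : ℝ)
    (ξ η : EuclideanSpace ℝ (Fin n)) :
    ∃ b : ℝ, ∀ ε : ℝ, P.disc t (ξ + ε • η) = P.disc t ξ + ε * b + ε ^ 2 * P.disc t η := by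
  obtain ⟨ι, _, k, l, q, -, hd⟩ := h.exists_disc_eq
  refine ⟨∑ i, (ξ (k i) * η (l i) + η (k i) * ξ (l i)) * q i t, fun ε => ?_⟩
  simp only [hd, PiLp.smul_apply, PiLp.add_apply, smul_eq_mul, Finset.mul_sum,
    ← Finset.sum_add_distrib]
  exact Finset.sum_congr rfl fun i _ => by ring

theorem AnalyticCoefficients.exists_disc_le (h : P.AnalyticCoefficients T) :
    ∃ K : ℝ, 0 ≤ K ∧ ∀ t ∈ Icc 0 T, ∀ ξ : EuclideanSpace ℝ (Fin n),
      P.disc t ξ ≤ K * ‖ξ‖ ^ 2 := by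
  obtain ⟨ι, _, k, l, q, hq, hd⟩ := h.exists_disc_eq
  choose K hK using fun i => isCompact_Icc.exists_bound_of_continuousOn (hq i).continuousOn
  refine ⟨∑ i, |K i|, Finset.sum_nonneg fun i _ => abs_nonneg _, fun t ht ξ => ?_⟩
  rw [hd, Finset.sum_mul]
  refine Finset.sum_le_sum fun i _ => ?_
  have h1 := PiLp.norm_apply_le ξ (k i)
  have h2 := PiLp.norm_apply_le ξ (l i)
  have h3 := (hK i t ht).trans (le_abs_self _)
  calc ξ (k i) * ξ (l i) * q i t ≤ ‖ξ (k i) * ξ (l i) * q i t‖ := Real.le_norm_self _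
    _ = ‖ξ (k i)‖ * ‖ξ (l i)‖ * ‖q i t‖ := by rw [norm_mul, norm_mul]
    _ ≤ ‖ξ‖ * ‖ξ‖ * |K i| := by gcongr
    _ = |K i| * ‖ξ‖ ^ 2 := by ring

theorem WeaklyHyperbolic.disc_nonneg (hP : P.WeaklyHyperbolic T) {t : ℝ} (ht : t ∈ Icc 0 T)
    (ξ : EuclideanSpace ℝ (Fin n)) : 0 ≤ P.disc t ξ := (hP.disc_spec ht ξ).1

/-- A direction in the kernel of the quadratic form `Δ(t, ·)` does not contribute to it. -/
theorem WeaklyHyperbolic.disc_add_smul (hP : P.WeaklyHyperbolic T)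
    (h : P.AnalyticCoefficients T) {t : ℝ} (ht : t ∈ Icc 0 T) {ξ : EuclideanSpace ℝ (Fin n)}
    (hξ : P.disc t ξ = 0) (η : EuclideanSpace ℝ (Fin n)) (ε : ℝ) :
    P.disc t (ξ + ε • η) = ε ^ 2 * P.disc t η := by
  obtain ⟨b, hb⟩ := h.exists_disc_add_smul t ξ η
  have hη := hP.disc_nonneg ht η
  -- A nonnegative polynomial `ε b + ε² d` with `d ≥ 0` has no linear term: at `ε = -b / (d + 1)`
  -- its value is `-(b / (d + 1))²`. The `+ 1` covers `d = 0`.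
  have hb0 : b = 0 := by
    have h1 := hP.disc_nonneg ht (ξ + (-b / (P.disc t η + 1)) • η)
    rw [hb, hξ] at h1
    have h2 : -b / (P.disc t η + 1) * b + (-b / (P.disc t η + 1)) ^ 2 * P.disc t η =
        -(b / (P.disc t η + 1)) ^ 2 := by
      field_simp
      ring
    rw [zero_add, h2] at h1
    have h3 : b / (P.disc t η + 1) = 0 := by
      have := sq_nonneg (b / (P.disc t η + 1))
      exact pow_eq_zero_iff two_ne_zero |>.1 (by linarith)
    exact (div_eq_zero_iff.1 h3).resolve_right (by linarith)
  rw [hb, hb0, hξ]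
  ring

theorem AnalyticCoefficients.symNcheck_roots (h : P.AnalyticCoefficients T)
    (hP : P.WeaklyHyperbolic T) {t : ℝ} (ht : t ∈ Icc 0 T) (ξ : EuclideanSpace ℝ (Fin n)) :
    P.symNcheck t (P.σ₁ t ξ) ξ = P.mid t ξ - P.slope t * (√(P.disc t ξ) / 2 : ℝ) ∧
    P.symNcheck t (P.σ₂ t ξ) ξ = P.mid t ξ + P.slope t * (√(P.disc t ξ) / 2 : ℝ) ∧
    P.symNcheck t (P.μ₁ t ξ) ξ = P.mid t ξ - P.slope t * (√(P.disc t ξ + 8) / 2 : ℝ) ∧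
    P.symNcheck t (P.μ₂ t ξ) ξ = P.mid t ξ + P.slope t * (√(P.disc t ξ + 8) / 2 : ℝ) ∧
    |P.σ₂ t ξ - P.σ₁ t ξ| = √(P.disc t ξ) ∧ |P.μ₂ t ξ - P.μ₁ t ξ| = √(P.disc t ξ + 8) := by
  obtain ⟨-, -, h1, h2, h3, h4⟩ := hP.disc_spec ht ξ
  simp only [h.symNcheck_eq ht, h1, h2, h3, h4]
  refine ⟨?_, ?_, ?_, ?_, ?_, ?_⟩
  · push_cast; ring
  · push_cast; ring
  · push_cast; ring
  · push_cast; ring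
  · rw [← abs_of_nonneg (Real.sqrt_nonneg (P.disc t ξ))]; congr 1; ring_nf
    rw [abs_of_nonneg (Real.sqrt_nonneg (P.disc t ξ))]
  · rw [← abs_of_nonneg (Real.sqrt_nonneg (P.disc t ξ + 8))]; congr 1; ring_nf
    rw [abs_of_nonneg (Real.sqrt_nonneg _)]

theorem AnalyticCoefficients.exists_slope_le (h : P.AnalyticCoefficients T) :
    ∃ E : ℝ, 0 ≤ E ∧ ∀ t ∈ Icc 0 T, ∀ x : ℝ, 0 ≤ x → ‖P.slope t * (x / 2 : ℝ)‖ ≤ E * x := by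
  obtain ⟨E, hE⟩ := isCompact_Icc.exists_bound_of_continuousOn h.slope.continuousOn
  refine ⟨|E|, abs_nonneg _, fun t ht x hx => ?_⟩
  rw [norm_mul, Complex.norm_real, Real.norm_of_nonneg (by linarith)]
  have := (hE t ht).trans (le_abs_self E)
  nlinarith [norm_nonneg (P.slope t)]

theorem sqrt_add_le {x y : ℝ} (hx : 0 ≤ x) (hy : 0 ≤ y) : √(x + y) ≤ √x + √y := by
  rw [Real.sqrt_le_left (by positivity), add_sq, Real.sq_sqrt hx, Real.sq_sqrt hy]
  have : 0 ≤ 2 * √x * √y := by positivity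
  linarith

theorem rpow_three_halves {x : ℝ} (hx : 0 ≤ x) : x ^ (3 / 2 : ℝ) = x * √x := by
  rw [Real.sqrt_eq_rpow, show (3 / 2 : ℝ) = 1 + 1 / 2 by norm_num,
    Real.rpow_add_of_nonneg hx (by norm_num) (by norm_num), Real.rpow_one]

/-- `Δ` is identified with `disc` only on `[0, T]`, where the roots are real, whereas `disc` is
differentiable across the endpoints. -/
theorem AnalyticCoefficients.derivWithin_Δ (h : P.AnalyticCoefficients T)
    (hP : P.WeaklyHyperbolic T) (hT : 0 < T) {t : ℝ} (ht : t ∈ Icc 0 T)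
    (ξ : EuclideanSpace ℝ (Fin n)) :
    derivWithin (fun s => P.Δ s ξ) (Icc 0 T) t = deriv (fun s => P.disc s ξ) t := by
  rw [derivWithin_congr (f := fun s => P.disc s ξ) (fun s hs => (hP.disc_spec hs ξ).2.1)
    (hP.disc_spec ht ξ).2.1]
  exact (h.disc_analytic ξ t ht).differentiableAt.derivWithin (uniqueDiffOn_Icc hT t ht)

/-- `2 * mid` is the sum of the values of `Ň` at `σ₁` and `σ₂`; conversely the `slope` term is
`O(√disc)`, already present on the right. -/
theorem pointwiseLevi_iff (h : P.AnalyticCoefficients T) (hP : P.WeaklyHyperbolic T)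
    (hT : 0 < T) : P.PointwiseLevi T ↔ ∃ C : ℝ, ∀ t ∈ Icc 0 T, ∀ ξ : EuclideanSpace ℝ (Fin n),
      P.disc t ξ ≠ 0 → ‖P.mid t ξ‖ ≤ C * (√(P.disc t ξ) +
        deriv (fun s => P.disc s ξ) t ^ 2 / (P.disc t ξ * √(P.disc t ξ))) := by
  constructor
  · rintro ⟨C, -, hC⟩
    refine ⟨C, fun t ht ξ hd => ?_⟩
    obtain ⟨h1, h2, -⟩ := h.symNcheck_roots hP ht ξ
    obtain ⟨k1, k2⟩ := hC t ht ξ (by rwa [(hP.disc_spec ht ξ).2.1])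
    rw [(hP.disc_spec ht ξ).2.1, h.derivWithin_Δ hP hT ht,
      rpow_three_halves (hP.disc_nonneg ht ξ)] at k1 k2
    rw [h1] at k1
    rw [h2] at k2
    have h3 := norm_add_le (P.mid t ξ - P.slope t * (√(P.disc t ξ) / 2 : ℝ))
      (P.mid t ξ + P.slope t * (√(P.disc t ξ) / 2 : ℝ))
    rw [sub_add_add_cancel, ← two_mul, norm_mul, Complex.norm_two] at h3
    linarith
  · rintro ⟨C, hC⟩
    obtain ⟨E, hE0, hE⟩ := h.exists_slope_le
    refine ⟨|C| + E + 1, by positivity, fun t ht ξ hd => ?_⟩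
    obtain ⟨h1, h2, -⟩ := h.symNcheck_roots hP ht ξ
    have hd0 := hP.disc_nonneg ht ξ
    rw [(hP.disc_spec ht ξ).2.1] at hd ⊢
    rw [h.derivWithin_Δ hP hT ht, rpow_three_halves hd0, h1, h2]
    have k1 := hC t ht ξ hd
    have k2 := hE t ht (√(P.disc t ξ)) (Real.sqrt_nonneg _)
    set s := √(P.disc t ξ)
    set r := deriv (fun s => P.disc s ξ) t ^ 2 / (P.disc t ξ * s)
    have hs : 0 ≤ s := Real.sqrt_nonneg _
    have hr : 0 ≤ r := by positivity
    have hfin : ‖P.mid t ξ‖ + ‖P.slope t * (s / 2 : ℝ)‖ ≤ (|C| + E + 1) * (s + r) := by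
      have := mul_le_mul_of_nonneg_right (le_abs_self C) (add_nonneg hs hr)
      nlinarith [mul_nonneg hE0 hr]
    exact ⟨(norm_sub_le _ _).trans hfin, (norm_add_le _ _).trans hfin⟩

/-- The `slope` term is `O(√disc)` and the product is bounded on `[0, T]`, so the difference of the
two left-hand sides is absorbed in the constant. -/
theorem productLevi_iff (h : P.AnalyticCoefficients T) (hP : P.WeaklyHyperbolic T) :
    P.ProductLevi T ↔ ∃ S : Finset ℝ, ∃ C : ℝ, ∀ t ∈ Icc 0 T, ∀ ξ : EuclideanSpace ℝ (Fin n),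
      (∏ s ∈ S, (t - s) ^ 2) * ‖P.mid t ξ‖ ≤ C * √(P.disc t ξ) := by
  obtain ⟨E, hE0, hE⟩ := h.exists_slope_le
  have hprod : ∀ S : Finset ℝ, ∃ K : ℝ, 0 ≤ K ∧ ∀ t ∈ Icc 0 T, ∏ s ∈ S, (t - s) ^ 2 ≤ K := by
    intro S
    obtain ⟨K, hK⟩ := (isCompact_Icc (a := (0 : ℝ)) (b := T)).exists_bound_of_continuousOn
      (f := fun t => ∏ s ∈ S, (t - s) ^ 2) (by fun_prop)
    exact ⟨|K|, abs_nonneg _, fun t ht =>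
      (Real.le_norm_self _).trans ((hK t ht).trans (le_abs_self _))⟩
  have hpos : ∀ (S : Finset ℝ) (t : ℝ), 0 ≤ ∏ s ∈ S, (t - s) ^ 2 := fun S t =>
    Finset.prod_nonneg fun s _ => sq_nonneg _
  constructor
  · rintro ⟨S, C, -, hC⟩
    obtain ⟨K, hK0, hK⟩ := hprod S
    refine ⟨S, C + K * E, fun t ht ξ => ?_⟩
    obtain ⟨h1, -, -, -, h5, -⟩ := h.symNcheck_roots hP ht ξ
    have k1 := hC t ht ξ
    rw [h1, h5] at k1
    have k2 := hE t ht (√(P.disc t ξ)) (Real.sqrt_nonneg _)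
    have k3 := norm_add_le (P.mid t ξ - P.slope t * (√(P.disc t ξ) / 2 : ℝ))
      (P.slope t * (√(P.disc t ξ) / 2 : ℝ))
    rw [sub_add_cancel] at k3
    have k4 := mul_le_mul (hK t ht) k2 (norm_nonneg _) hK0
    nlinarith [mul_le_mul_of_nonneg_left k3 (hpos S t)]
  · rintro ⟨S, C, hC⟩
    obtain ⟨K, hK0, hK⟩ := hprod S
    refine ⟨S, |C| + K * E + 1, by positivity, fun t ht ξ => ?_⟩
    obtain ⟨h1, -, -, -, h5, -⟩ := h.symNcheck_roots hP ht ξ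
    have k1 := hC t ht ξ
    rw [h1, h5]
    have k2 := hE t ht (√(P.disc t ξ)) (Real.sqrt_nonneg _)
    have k3 := norm_sub_le (P.mid t ξ) (P.slope t * (√(P.disc t ξ) / 2 : ℝ))
    have k4 := mul_le_mul (hK t ht) k2 (norm_nonneg _) hK0
    have k5 := mul_le_mul_of_nonneg_right (le_abs_self C) (Real.sqrt_nonneg (P.disc t ξ))
    nlinarith [mul_le_mul_of_nonneg_left k3 (hpos S t), Real.sqrt_nonneg (P.disc t ξ)]

/-- The reduced integrand of the integral Levi condition. -/
noncomputable def density (P : ThirdOrderOperator n) (ξ : EuclideanSpace ℝ (Fin n)) (t : ℝ) : ℝ :=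
  √(‖P.mid t ξ‖ / √(P.disc t ξ + 8))

theorem continuousOn_sqrt_norm_div (h : P.AnalyticCoefficients T) (hP : P.WeaklyHyperbolic T)
    (ξ : EuclideanSpace ℝ (Fin n)) {f : ℝ → ℂ} (hf : ContinuousOn f (Icc 0 T)) :
    ContinuousOn (fun t => √(‖f t‖ / √(P.disc t ξ + 8))) (Icc 0 T) := by
  have hd : ContinuousOn (fun t => √(P.disc t ξ + 8)) (Icc 0 T) :=
    ((h.disc_analytic ξ).continuousOn.add continuousOn_const).sqrt
  refine (hf.norm.div hd fun t ht => ?_).sqrt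
  have := hP.disc_nonneg ht ξ
  positivity

theorem continuousOn_density (h : P.AnalyticCoefficients T) (hP : P.WeaklyHyperbolic T)
    (ξ : EuclideanSpace ℝ (Fin n)) : ContinuousOn (P.density ξ) (Icc 0 T) :=
  continuousOn_sqrt_norm_div h hP ξ (h.mid_analytic ξ).continuousOn

/-- After division by `√(disc + 8)` the `slope` term is bounded. It therefore adds a bounded amount
to the integrand, and `log (1 + |ξ|) ≥ log 2` absorbs its integral. -/
theorem integralLevi_iff (h : P.AnalyticCoefficients T) (hP : P.WeaklyHyperbolic T)
    (hT : 0 < T) : P.IntegralLevi T ↔ ∃ C : ℝ, ∀ ξ : EuclideanSpace ℝ (Fin n), 1 ≤ ‖ξ‖ →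
      ∫ t in (0 : ℝ)..T, P.density ξ t ≤ C * Real.log (1 + ‖ξ‖) := by
  set I : EuclideanSpace ℝ (Fin n) → ℝ → ℝ := fun ξ t =>
    √(‖P.symNcheck t (P.μ₁ t ξ) ξ‖ / |P.μ₂ t ξ - P.μ₁ t ξ|)
      + √(‖P.symNcheck t (P.μ₂ t ξ) ξ‖ / |P.μ₂ t ξ - P.μ₁ t ξ|) with hI
  have hIeq : ∀ ξ, ∀ t ∈ Icc 0 T, I ξ t =
      √(‖P.mid t ξ - P.slope t * (√(P.disc t ξ + 8) / 2 : ℝ)‖ / √(P.disc t ξ + 8)) +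
      √(‖P.mid t ξ + P.slope t * (√(P.disc t ξ + 8) / 2 : ℝ)‖ / √(P.disc t ξ + 8)) := by
    intro ξ t ht
    obtain ⟨-, -, h3, h4, -, h6⟩ := h.symNcheck_roots hP ht ξ
    simp only [hI, h3, h4, h6]
  have hIc : ∀ ξ, ContinuousOn (I ξ) (Icc 0 T) := by
    intro ξ
    refine ContinuousOn.congr ?_ (hIeq ξ)
    have hm := (h.mid_analytic ξ).continuousOn
    have hs : ContinuousOn (fun t => P.slope t * (√(P.disc t ξ + 8) / 2 : ℝ)) (Icc 0 T) := by
      refine h.slope.continuousOn.mul (Complex.continuous_ofReal.comp_continuousOn ?_)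
      exact ((h.disc_analytic ξ).continuousOn.add continuousOn_const).sqrt.div_const 2
    exact (continuousOn_sqrt_norm_div h hP ξ (hm.sub hs)).add
      (continuousOn_sqrt_norm_div h hP ξ (hm.add hs))
  have hIi : ∀ ξ, IntervalIntegrable (I ξ) volume 0 T := fun ξ =>
    (hIc ξ).intervalIntegrable_of_Icc hT.le
  have hDi : ∀ ξ, IntervalIntegrable (P.density ξ) volume 0 T := fun ξ =>
    (continuousOn_density h hP ξ).intervalIntegrable_of_Icc hT.le
  constructor
  · rintro ⟨C, -, hC⟩
    refine ⟨C, fun ξ hξ => le_trans ?_ (hC ξ hξ).2⟩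
    refine intervalIntegral.integral_mono_on hT.le (hDi ξ) (hIi ξ) fun t ht => ?_
    change P.density ξ t ≤ I ξ t
    rw [hIeq ξ t ht, density]
    have hw : 0 < √(P.disc t ξ + 8) := by
      have := hP.disc_nonneg ht ξ
      positivity
    set w := √(P.disc t ξ + 8)
    set e := P.slope t * (w / 2 : ℝ)
    have h3 := norm_add_le (P.mid t ξ - e) (P.mid t ξ + e)
    rw [sub_add_add_cancel, ← two_mul, norm_mul, Complex.norm_two] at h3
    have h4 : ‖P.mid t ξ‖ / w ≤ ‖P.mid t ξ - e‖ / w + ‖P.mid t ξ + e‖ / w := by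
      rw [← add_div]
      gcongr
      linarith [norm_nonneg (P.mid t ξ)]
    exact (Real.sqrt_le_sqrt h4).trans (sqrt_add_le (by positivity) (by positivity))
  · rintro ⟨C, hC⟩
    obtain ⟨E, hE0, hE⟩ := h.exists_slope_le
    have hlog2 : 0 < Real.log 2 := Real.log_pos (by norm_num)
    refine ⟨2 * |C| + 2 * √E * T / Real.log 2 + 1, by positivity, fun ξ hξ => ⟨hIi ξ, ?_⟩⟩
    have hlog : Real.log 2 ≤ Real.log (1 + ‖ξ‖) := Real.log_le_log (by norm_num) (by linarith)
    have hle : ∫ t in (0 : ℝ)..T, I ξ t ≤ ∫ t in (0 : ℝ)..T, (2 * P.density ξ t + 2 * √E) := by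
      refine intervalIntegral.integral_mono_on hT.le (hIi ξ)
        (((hDi ξ).const_mul 2).add intervalIntegrable_const) fun t ht => ?_
      rw [hIeq ξ t ht, density]
      have hw : 0 < √(P.disc t ξ + 8) := by
        have := hP.disc_nonneg ht ξ
        positivity
      have k2 := hE t ht _ hw.le
      set w := √(P.disc t ξ + 8)
      set e := P.slope t * (w / 2 : ℝ)
      have key : ∀ x : ℂ, ‖x‖ ≤ ‖P.mid t ξ‖ + ‖e‖ →
          √(‖x‖ / w) ≤ √(‖P.mid t ξ‖ / w) + √E := by
        intro x hx
        refine (Real.sqrt_le_sqrt ?_).trans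
          (sqrt_add_le (by positivity) hE0)
        rw [div_add' _ _ _ hw.ne']
        gcongr
        linarith
      linarith [key _ (norm_sub_le (P.mid t ξ) e), key _ (norm_add_le (P.mid t ξ) e)]
    rw [intervalIntegral.integral_add ((hDi ξ).const_mul 2) intervalIntegrable_const,
      intervalIntegral.integral_const_mul, intervalIntegral.integral_const, smul_eq_mul,
      sub_zero] at hle
    have k1 := hC ξ hξ
    have k2 : 2 * √E * T ≤ 2 * √E * T / Real.log 2 * Real.log (1 + ‖ξ‖) := by
      rw [div_mul_eq_mul_div, le_div_iff₀ hlog2]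
      gcongr
    have k3 := mul_le_mul_of_nonneg_right (le_abs_self C) (hlog2.le.trans hlog)
    have k4 := hlog2.trans_le hlog
    change ∫ t in (0 : ℝ)..T, I ξ t ≤ _
    nlinarith

end ThirdOrderOperator

/-! ### From the pointwise to the integral condition -/

namespace ThirdOrderOperator

open Set Filter Topology MeasureTheory

variable {n : ℕ} {P : ThirdOrderOperator n} {T : ℝ}

/-- The derivative of `log (1 + √√p)` dominates the integrand of the Levi condition. -/
theorem sqrt_div_sqrt_le {p d g C : ℝ} (hp : 0 < p) (hC : 0 ≤ C)
    (hg : g ≤ C * (√p + d ^ 2 / (p * √p))) :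
    √(g / √(p + 8)) ≤ √C + 8 * √C * |d / (2 * √p) / (2 * √√p) / (1 + √√p)| := by
  set y := √√p with hy
  have hy0 : 0 < y := by positivity
  have hy2 : √p = y ^ 2 := (Real.sq_sqrt (Real.sqrt_nonneg p)).symm
  have hp4 : p = y ^ 4 := by
    rw [show y ^ 4 = (y ^ 2) ^ 2 by ring, ← hy2, Real.sq_sqrt hp.le]
  have hs1 : y ^ 2 ≤ √(p + 8) := by
    rw [← hy2]
    exact Real.sqrt_le_sqrt (by linarith)
  -- The summand `8` keeps the denominator away from zero, so it compensates the factor `1 + y` from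
  -- the logarithm even for small `y`.
  have hs2 : (1 + y) ^ 2 / 4 ≤ √(p + 8) := by
    refine Real.le_sqrt_of_sq_le ?_
    rw [hp4]
    nlinarith [sq_nonneg (y - 1), sq_nonneg (y ^ 2 - 1), sq_nonneg (y ^ 2 - y), sq_nonneg y]
  set s := √(p + 8)
  have hs0 : 0 < s := lt_of_lt_of_le (by positivity) hs1
  have hz : |d / (2 * √p) / (2 * y) / (1 + y)| = |d| / (4 * y ^ 3 * (1 + y)) := by
    rw [abs_div, abs_div, abs_div, abs_of_pos (show 0 < 1 + y by positivity),
      abs_of_pos (show 0 < 2 * y by positivity), abs_of_pos (show 0 < 2 * √p by positivity), hy2]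
    field_simp
    norm_num
  rw [hz]
  -- The factor `8` makes `z² (1 + y)² / 4` exactly `d² / (p √p)`, hence at least that term is
  -- bounded by `z² s`.
  set z := 8 * (|d| / (4 * y ^ 3 * (1 + y))) with hzdef
  have hz0 : 0 ≤ z := by positivity
  have key : g / s ≤ C * (1 + z) ^ 2 := by
    rw [div_le_iff₀ hs0]
    refine hg.trans ?_
    rw [mul_assoc]
    refine mul_le_mul_of_nonneg_left ?_ hC
    have e1 : d ^ 2 / (p * √p) = z ^ 2 * ((1 + y) ^ 2 / 4) := by
      rw [hy2, hp4, hzdef, ← sq_abs d]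
      field_simp
      norm_num
    rw [e1, hy2]
    nlinarith [mul_le_mul_of_nonneg_left hs2 (sq_nonneg z), mul_nonneg hz0 hs0.le]
  calc √(g / s) ≤ √(C * (1 + z) ^ 2) := Real.sqrt_le_sqrt key
    _ = √C * (1 + z) := by rw [Real.sqrt_mul hC, Real.sqrt_sq (by positivity)]
    _ = _ := by rw [hzdef]; ring

/-- Under the pointwise condition, `Ň` vanishes in the directions along which `Δ` vanishes
identically. -/
theorem mid_eq_zero_of_disc_eq_zero (h : P.AnalyticCoefficients T) (hP : P.WeaklyHyperbolic T)
    (hT : 0 < T) {C : ℝ}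
    (hC : ∀ t ∈ Icc 0 T, ∀ ξ : EuclideanSpace ℝ (Fin n), P.disc t ξ ≠ 0 →
      ‖P.mid t ξ‖ ≤ C * (√(P.disc t ξ) +
        deriv (fun s => P.disc s ξ) t ^ 2 / (P.disc t ξ * √(P.disc t ξ))))
    {ξ η : EuclideanSpace ℝ (Fin n)} (hξ : ∀ t ∈ Icc 0 T, P.disc t ξ = 0) {t : ℝ}
    (ht : t ∈ Icc 0 T) (hη : P.disc t η ≠ 0) : P.mid t ξ = 0 := by
  set R := C * (√(P.disc t η) +
        deriv (fun s => P.disc s η) t ^ 2 / (P.disc t η * √(P.disc t η))) with hR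
  -- Along `ξ + ε • η` the form `disc` is `ε² disc η`, and the right side of the pointwise bound has
  -- degree one in `ε`, while `mid` tends to `mid ξ`. Letting `ε → 0` gives the claim.
  have key : ∀ ε > 0, ‖P.mid t ξ‖ ≤ ε * (R + ‖P.mid t η‖) := by
    intro ε hε
    have hd : ∀ s ∈ Icc 0 T, P.disc s (ξ + ε • η) = ε ^ 2 * P.disc s η := fun s hs =>
      hP.disc_add_smul h hs (hξ s hs) η ε
    have hder : deriv (fun s => P.disc s (ξ + ε • η)) t =
        ε ^ 2 * deriv (fun s => P.disc s η) t := by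
      have hu := uniqueDiffOn_Icc hT t ht
      rw [← (h.disc_analytic (ξ + ε • η) t ht).differentiableAt.derivWithin hu,
        ← (h.disc_analytic η t ht).differentiableAt.derivWithin hu, derivWithin_congr hd (hd t ht)]
      exact derivWithin_const_mul_field _
    have h1 := hC t ht (ξ + ε • η) (by rw [hd t ht]; positivity)
    have hsq : √(P.disc t (ξ + ε • η)) = ε * √(P.disc t η) := by
      rw [hd t ht, Real.sqrt_mul (by positivity), Real.sqrt_sq hε.le]
    rw [hder, hsq, hd t ht, h.mid_add, h.mid_smul] at h1
    have h2 : (ε ^ 2 * deriv (fun s => P.disc s η) t) ^ 2 /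
        (ε ^ 2 * P.disc t η * (ε * √(P.disc t η))) =
        ε * (deriv (fun s => P.disc s η) t ^ 2 / (P.disc t η * √(P.disc t η))) := by
      have hpos : 0 < P.disc t η := lt_of_le_of_ne (hP.disc_nonneg ht η) hη.symm
      field_simp
    rw [h2, ← mul_add, mul_left_comm, ← hR] at h1
    have h3 := norm_sub_le (P.mid t ξ + ε * P.mid t η) (ε * P.mid t η)
    rw [add_sub_cancel_right, norm_mul, Complex.norm_real, Real.norm_of_nonneg hε.le] at h3
    linarith
  have hR0 : 0 ≤ R + ‖P.mid t η‖ := by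
    have := (norm_nonneg _).trans (key 1 one_pos)
    linarith
  rw [← norm_le_zero_iff]
  refine le_of_forall_pos_le_add fun δ hδ => (key (δ / (R + ‖P.mid t η‖ + 1)) (by positivity)).trans ?_
  rw [zero_add, div_mul_eq_mul_div, div_le_iff₀ (by positivity)]
  nlinarith

theorem integral_le_of_le_off_finite {w : ℝ → ℝ} {a b C : ℝ} (hab : a ≤ b)
    (hw : ContinuousOn w (Icc a b)) {S : Set ℝ} (hS : S.Finite)
    (h : ∀ t ∈ Icc a b, t ∉ S → w t ≤ C) : ∫ t in a..b, w t ≤ C * (b - a) := by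
  have : ∫ t in a..b, w t ≤ ∫ _ in a..b, C := by
    refine intervalIntegral.integral_mono_ae_restrict hab (hw.intervalIntegrable_of_Icc hab)
      intervalIntegrable_const ?_
    have h1 : ∀ᵐ t ∂(volume.restrict (Icc a b)), t ∉ S :=
      ae_restrict_of_ae (measure_eq_zero_iff_ae_notMem.1 (hS.measure_zero _))
    filter_upwards [h1, ae_restrict_mem measurableSet_Icc] with t h1 h2 using h t h2 h1
  rwa [intervalIntegral.integral_const, smul_eq_mul, mul_comm] at this

/-- The number of critical points of `Δ(·, ξ)` is bounded uniformly in `ξ`. -/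
theorem exists_card_critical_le (h : P.AnalyticCoefficients T) (hT : 0 < T) :
    ∃ N : ℕ, ∀ ξ : EuclideanSpace ℝ (Fin n),
      (∀ t ∈ Icc 0 T, deriv (fun s => P.disc s ξ) t = 0) ∨
      ∃ S : Finset ℝ, S.card ≤ N ∧
        ∀ t ∈ Icc 0 T, deriv (fun s => P.disc s ξ) t = 0 → t ∈ S := by
  obtain ⟨ι, _, k, l, q, hq, hd⟩ := h.exists_disc_eq
  obtain ⟨N, hN⟩ := exists_card_zeros_le hT Finset.univ (fun i => deriv (q i))
    (fun i _ => (hq i).deriv)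
  refine ⟨N, fun ξ => ?_⟩
  have hder : ∀ t ∈ Icc 0 T, deriv (fun s => P.disc s ξ) t =
      ∑ i, ξ (k i) * ξ (l i) * deriv (q i) t := by
    intro t ht
    simp only [hd]
    exact (HasDerivAt.fun_sum fun i _ =>
      (hq i t ht).differentiableAt.hasDerivAt.const_mul _).deriv
  rcases hN fun i => ξ (k i) * ξ (l i) with h0 | hF
  · exact Or.inl fun t ht => (hder t ht).trans (h0 t ht)
  · right
    have hfin : {t | t ∈ Icc 0 T ∧ ∑ i, ξ (k i) * ξ (l i) * deriv (q i) t = 0}.Finite := by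
      by_contra hinf
      obtain ⟨G, hG, hGc⟩ := Set.Infinite.exists_subset_card_eq hinf (N + 1)
      have := hF G fun t ht => hG ht
      omega
    refine ⟨hfin.toFinset, hF _ fun t ht => by rwa [Set.Finite.mem_toFinset] at ht,
      fun t ht h0 => ?_⟩
    rw [Set.Finite.mem_toFinset]
    exact ⟨ht, by rw [← hder t ht, h0]⟩

/-- Turns the quadratic growth of `disc` in `ξ` into a logarithmic bound on the potential `log (1 +
disc ^ (1/4))`. -/
theorem log_one_add_sqrt_le {K x : ℝ} (hK : 0 ≤ K) (hx : 1 ≤ x) {p : ℝ} (hp : p ≤ K * x ^ 2) :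
    Real.log (1 + √√p) ≤ (Real.log (1 + √K) / Real.log 2 + 1) * Real.log (1 + x) := by
  have hlog2 : 0 < Real.log 2 := Real.log_pos (by norm_num)
  have h1 : √√p ≤ √(√K * x) := by
    refine Real.sqrt_le_sqrt ((Real.sqrt_le_sqrt hp).trans ?_)
    rw [Real.sqrt_mul hK, Real.sqrt_sq (by linarith)]
  have h2 : √(√K * x) ≤ √K + x := by
    refine Real.sqrt_le_iff.2 ⟨by positivity, ?_⟩
    nlinarith [Real.sqrt_nonneg K, sq_nonneg (√K)]
  have h3 : 1 + √√p ≤ (1 + √K) * (1 + x) := by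
    nlinarith [Real.sqrt_nonneg K]
  have h4 : Real.log (1 + √√p) ≤ Real.log (1 + √K) + Real.log (1 + x) := by
    rw [← Real.log_mul (by positivity) (by positivity)]
    exact Real.log_le_log (by positivity) h3
  have h5 : Real.log 2 ≤ Real.log (1 + x) := Real.log_le_log (by norm_num) (by linarith)
  have h6 : 0 ≤ Real.log (1 + √K) := Real.log_nonneg (by linarith [Real.sqrt_nonneg K])
  have h7 : Real.log (1 + √K) ≤ Real.log (1 + √K) / Real.log 2 * Real.log (1 + x) := by
    rw [div_mul_eq_mul_div, le_div_iff₀ hlog2]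
    gcongr
  linarith

theorem integral_density_le (h : P.AnalyticCoefficients T) (hP : P.WeaklyHyperbolic T)
    (hT : 0 < T) {C : ℝ} (hC0 : 0 ≤ C)
    (hC : ∀ t ∈ Icc 0 T, ∀ ξ : EuclideanSpace ℝ (Fin n), P.disc t ξ ≠ 0 →
      ‖P.mid t ξ‖ ≤ C * (√(P.disc t ξ) +
        deriv (fun s => P.disc s ξ) t ^ 2 / (P.disc t ξ * √(P.disc t ξ))))
    {η : EuclideanSpace ℝ (Fin n)} (hη : ∃ t ∈ Icc 0 T, P.disc t η ≠ 0)
    {ξ : EuclideanSpace ℝ (Fin n)} {N : ℕ} {B : ℝ} (hB0 : 0 ≤ B)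
    (hB : ∀ t ∈ Icc 0 T, Real.log (1 + √√(P.disc t ξ)) ≤ B)
    (hN : (∀ t ∈ Icc 0 T, deriv (fun s => P.disc s ξ) t = 0) ∨
      ∃ S : Finset ℝ, S.card ≤ N ∧
        ∀ t ∈ Icc 0 T, deriv (fun s => P.disc s ξ) t = 0 → t ∈ S) :
    ∫ t in (0 : ℝ)..T, P.density ξ t ≤ √C * T + (N + 1) * (8 * √C * B) := by
  have hw := continuousOn_density h hP ξ
  have hpd := h.disc_analytic ξ
  have hder : ∀ t ∈ Icc 0 T, HasDerivAt (fun s => P.disc s ξ) (deriv (fun s => P.disc s ξ) t) t :=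
    fun t ht => (hpd t ht).differentiableAt.hasDerivAt
  have hbound : ∀ t ∈ Icc 0 T, P.disc t ξ ≠ 0 → P.density ξ t ≤ √C + 8 * √C *
      |deriv (fun s => P.disc s ξ) t / (2 * √(P.disc t ξ)) / (2 * √√(P.disc t ξ)) /
        (1 + √√(P.disc t ξ))| := fun t ht hne =>
    sqrt_div_sqrt_le (lt_of_le_of_ne (hP.disc_nonneg ht ξ) hne.symm) hC0 (hC t ht ξ hne)
  rcases hN with hconst | ⟨S, hS, hcrit⟩
  -- When `disc` is constant in `t` there is no finite critical set. If the constant is zero then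
  -- `mid` vanishes off the finitely many zeros of `disc η`; otherwise the derivative term drops out
  -- of the bound.
  · have hrest : 0 ≤ ((N : ℝ) + 1) * (8 * √C * B) := by positivity
    have hmain : ∫ t in (0 : ℝ)..T, P.density ξ t ≤ √C * (T - 0) := by
      by_cases hz : ∀ t ∈ Icc 0 T, P.disc t ξ = 0
      · refine integral_le_of_le_off_finite hT.le hw
          ((h.disc_analytic η).finite_zeros_Icc hη) fun t ht hn => ?_
        have hm := mid_eq_zero_of_disc_eq_zero h hP hT hC hz ht (η := η) fun h0 => hn ⟨ht, h0⟩
        rw [density, hm, norm_zero, zero_div, Real.sqrt_zero]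
        exact Real.sqrt_nonneg _
      · push Not at hz
        refine integral_le_of_le_off_finite hT.le hw (hpd.finite_zeros_Icc hz) fun t ht hn => ?_
        have := hbound t ht fun h0 => hn ⟨ht, h0⟩
        simpa [hconst t ht] using this
    linarith
  · have hFc : ContinuousOn (fun t => Real.log (1 + √√(P.disc t ξ))) (Icc 0 T) :=
      (continuousOn_const.add hpd.continuousOn.sqrt.sqrt).log fun t _ =>
        (by positivity : (1 : ℝ) + √√(P.disc t ξ) ≠ 0)
    have := integral_le_of_le_abs_deriv (K := 8 * √C) (C := √C) (B := B) (by positivity) S N hT.le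
      ((Finset.card_filter_le _ _).trans hS) hFc hw
      (F' := fun t => deriv (fun s => P.disc s ξ) t / (2 * √(P.disc t ξ)) /
        (2 * √√(P.disc t ξ)) / (1 + √√(P.disc t ξ)))
      (fun t ht => ⟨Real.log_nonneg (by linarith [Real.sqrt_nonneg √(P.disc t ξ)]), hB t ht⟩)
      fun t ht htS => ?_
    · rwa [sub_zero] at this
    · have htI := Ioo_subset_Icc_self ht
      have hd0 : deriv (fun s => P.disc s ξ) t ≠ 0 := fun h0 => htS (hcrit t htI h0)
      -- An interior zero of the nonnegative `disc` is a minimum, hence critical, hence in `S`; so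
      -- `S` also contains all points where the fourth root may fail to be differentiable.
      have hne : P.disc t ξ ≠ 0 := by
        intro h0
        refine hd0 (IsLocalMin.deriv_eq_zero ?_)
        filter_upwards [Ioo_mem_nhds ht.1 ht.2] with s hs
        rw [h0]
        exact hP.disc_nonneg (Ioo_subset_Icc_self hs) ξ
      have hpos : 0 < P.disc t ξ := lt_of_le_of_ne (hP.disc_nonneg htI ξ) hne.symm
      refine ⟨?_, ?_, hbound t htI hne⟩
      · exact ((((hder t htI).sqrt hne).sqrt (by positivity)).const_add 1).log (by positivity)
      · have h1 : 0 < √(P.disc t ξ) := by positivity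
        have h2 : 0 < √√(P.disc t ξ) := by positivity
        positivity

theorem PointwiseLevi.integralLevi (hA : P.PointwiseLevi T) (h : P.AnalyticCoefficients T)
    (hP : P.WeaklyHyperbolic T) (hT : 0 < T)
    (hη : ∃ η : EuclideanSpace ℝ (Fin n), ∃ t ∈ Icc 0 T, P.disc t η ≠ 0) : P.IntegralLevi T := by
  obtain ⟨C, hC⟩ := (pointwiseLevi_iff h hP hT).1 hA
  obtain ⟨η, hη⟩ := hη
  obtain ⟨K, hK0, hK⟩ := h.exists_disc_le
  obtain ⟨N, hN⟩ := exists_card_critical_le h hT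
  have hlog2 : 0 < Real.log 2 := Real.log_pos (by norm_num)
  refine (integralLevi_iff h hP hT).2 ⟨√|C| * T / Real.log 2 +
    (N + 1) * (8 * √|C| * (Real.log (1 + √K) / Real.log 2 + 1)), fun ξ hξ => ?_⟩
  have hlog : Real.log 2 ≤ Real.log (1 + ‖ξ‖) := Real.log_le_log (by norm_num) (by linarith)
  have hlogK : 0 ≤ Real.log (1 + √K) := Real.log_nonneg (by linarith [Real.sqrt_nonneg K])
  have hlogξ := hlog2.trans_le hlog
  have h1 := integral_density_le h hP hT (abs_nonneg C) (fun t ht ξ hne =>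
    (hC t ht ξ hne).trans (mul_le_mul_of_nonneg_right (le_abs_self C)
      (by have := hP.disc_nonneg ht ξ; positivity))) hη (by positivity)
    (fun t ht => log_one_add_sqrt_le hK0 hξ (hK t ht ξ)) (hN ξ)
  have h2 : √|C| * T ≤ √|C| * T / Real.log 2 * Real.log (1 + ‖ξ‖) := by
    rw [div_mul_eq_mul_div, le_div_iff₀ hlog2]
    gcongr
  linear_combination h1 + h2

end ThirdOrderOperator

/-! ### Orders of vanishing of analytic functions of `t` -/

section OneVariable

open Set Filter Topology MeasureTheory

theorem IsCompact.exists_le_mul_of_local {X : Type*} [TopologicalSpace X] {s : Set X}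
    (hs : IsCompact s) {Q : X → Prop} {f g : X → ℝ} (hg : ∀ t ∈ s, Q t → 0 ≤ g t)
    (hloc : ∀ x ∈ s, ∃ C : ℝ, ∀ᶠ t in 𝓝[s] x, Q t → f t ≤ C * g t) :
    ∃ C : ℝ, ∀ t ∈ s, Q t → f t ≤ C * g t := by
  have := hs.induction_on (p := fun U => ∃ C : ℝ, ∀ t ∈ U, t ∈ s → Q t → f t ≤ C * g t)
    ⟨0, by simp⟩ (fun U V hUV ⟨C, hC⟩ => ⟨C, fun t ht => hC t (hUV ht)⟩) ?_ ?_
  · obtain ⟨C, hC⟩ := this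
    exact ⟨C, fun t ht => hC t ht ht⟩
  · rintro U V ⟨C, hC⟩ ⟨D, hD⟩
    refine ⟨max C D, fun t ht hts hQ => ?_⟩
    have h0 := hg t hts hQ
    rcases ht with ht | ht
    · exact (hC t ht hts hQ).trans (mul_le_mul_of_nonneg_right (le_max_left _ _) h0)
    · exact (hD t ht hts hQ).trans (mul_le_mul_of_nonneg_right (le_max_right _ _) h0)
  · intro x hx
    obtain ⟨C, hC⟩ := hloc x hx
    exact ⟨_, hC, C, fun t ht _ => ht⟩

theorem ContinuousAt.eventually_norm_le_mul {E : Type*} [NormedAddCommGroup E] {f : ℝ → E}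
    {g : ℝ → ℝ} {x : ℝ} (hf : ContinuousAt f x) (hg : ContinuousAt g x) (hgx : 0 < g x) :
    ∃ C : ℝ, ∀ᶠ t in 𝓝 x, ‖f t‖ ≤ C * g t := by
  refine ⟨(‖f x‖ + 1) / g x, ?_⟩
  have h1 : ContinuousAt (fun t => (‖f x‖ + 1) / g x * g t - ‖f t‖) x :=
    (continuousAt_const.mul hg).sub hf.norm
  have h2 : 0 < (‖f x‖ + 1) / g x * g x - ‖f x‖ := by
    rw [div_mul_cancel₀ _ hgx.ne']
    linarith
  filter_upwards [h1.eventually (lt_mem_nhds h2)] with t ht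
  linarith

/-- Writing `q = (t - x)^k u` with `u x ≠ 0` and `k ≥ 1`, one has `(t - x) q' = (t - x)^k (k u + (t
- x) u')`, and near `x` the last factor is at least `|u| / 2` in absolute value. -/
theorem AnalyticAt.eventually_abs_le_mul_deriv {q : ℝ → ℝ} {x : ℝ} (hq : AnalyticAt ℝ q x)
    (hqx : q x = 0) (hne : ¬∀ᶠ t in 𝓝 x, q t = 0) :
    ∀ᶠ t in 𝓝 x, |q t| ≤ 2 * |t - x| * |deriv q t| := by
  obtain ⟨k, u, hu, hux, hev⟩ := hq.exists_eventuallyEq_pow_smul_nonzero_iff.2 hne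
  obtain ⟨j, rfl⟩ : ∃ j, k = j + 1 := by
    refine Nat.exists_eq_succ_of_ne_zero ?_
    rintro rfl
    have := hev.self_of_nhds
    rw [hqx, pow_zero, one_smul] at this
    exact hux this.symm
  have hcont : ContinuousAt (fun t => 2 * |(j + 1) * u t + (t - x) * deriv u t| - |u t|) x := by
    have := hu.deriv.continuousAt
    have := hu.continuousAt
    fun_prop
  have hpos : 0 < 2 * |(j + 1) * u x + (x - x) * deriv u x| - |u x| := by
    rw [sub_self, zero_mul, add_zero, abs_mul, abs_of_pos (by positivity : (0 : ℝ) < j + 1)]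
    have := abs_pos.2 hux
    have hj : (0 : ℝ) ≤ j := by positivity
    nlinarith
  filter_upwards [hcont.eventually (lt_mem_nhds hpos), hev, hev.eventually_nhds,
    hu.eventually_analyticAt] with t h1 h2 h3 h4
  have hd : deriv q t = (j + 1) * (t - x) ^ j * u t + (t - x) ^ (j + 1) * deriv u t := by
    rw [Filter.EventuallyEq.deriv_eq h3]
    simp only [smul_eq_mul]
    refine HasDerivAt.deriv ?_
    refine ((((hasDerivAt_id t).sub_const x).fun_pow (j + 1)).mul
      h4.differentiableAt.hasDerivAt).congr_deriv ?_
    simp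
  have h5 : (t - x) * deriv q t =
      (t - x) ^ (j + 1) * ((j + 1) * u t + (t - x) * deriv u t) := by
    rw [hd]; ring
  rw [mul_assoc, ← abs_mul, h5, h2, smul_eq_mul, abs_mul, abs_mul]
  have := abs_nonneg ((t - x) ^ (j + 1))
  nlinarith

theorem not_eventually_eq_zero {q : ℝ → ℝ} {T : ℝ} (hq : AnalyticOnNhd ℝ q (Icc 0 T))
    (hne : ∃ t ∈ Icc 0 T, q t ≠ 0) {x : ℝ} (hx : x ∈ Icc 0 T) : ¬∀ᶠ t in 𝓝 x, q t = 0 := by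
  intro hev
  obtain ⟨t, ht, htq⟩ := hne
  exact htq (hq.eqOn_zero_of_preconnected_of_eventuallyEq_zero isPreconnected_Icc hx hev ht)

/-- The zeros of `q` serve as exceptional points. Near one of them the remaining factors are
bounded; elsewhere `√q` is bounded below locally, and compactness glues the constants. -/
theorem exists_prod_le_of_local {q : ℝ → ℝ} {h : ℝ → ℂ} {T : ℝ}
    (hq : AnalyticOnNhd ℝ q (Icc 0 T)) (hh : AnalyticOnNhd ℝ h (Icc 0 T))
    (hq0 : ∀ t ∈ Icc 0 T, 0 ≤ q t) (hne : ∃ t ∈ Icc 0 T, q t ≠ 0)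
    (hloc : ∀ x ∈ Icc 0 T, q x = 0 →
      ∃ C : ℝ, ∀ᶠ t in 𝓝[Icc 0 T] x, (t - x) ^ 2 * ‖h t‖ ≤ C * √(q t)) :
    ∃ (S : Finset ℝ) (C : ℝ), ∀ t ∈ Icc 0 T, (∏ s ∈ S, (t - s) ^ 2) * ‖h t‖ ≤ C * √(q t) := by
  classical
  set S := (hq.finite_zeros_Icc hne).toFinset with hS
  refine ⟨S, ?_⟩
  suffices ∃ C : ℝ, ∀ t ∈ Icc 0 T, True → (∏ s ∈ S, (t - s) ^ 2) * ‖h t‖ ≤ C * √(q t) by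
    simpa using this
  refine isCompact_Icc.exists_le_mul_of_local (fun t _ _ => Real.sqrt_nonneg _) fun x hx => ?_
  simp only [forall_const]
  by_cases hqx : q x = 0
  · obtain ⟨C, hC⟩ := hloc x hx hqx
    have hxS : x ∈ S := by
      rw [hS, Set.Finite.mem_toFinset]
      exact ⟨hx, hqx⟩
    have hcont : ContinuousAt (fun t => ∏ s ∈ S.erase x, (t - s) ^ 2) x := by fun_prop
    obtain ⟨D, hD⟩ := hcont.eventually_norm_le_mul (g := fun _ => 1) continuousAt_const one_pos
    refine ⟨D * C, ?_⟩
    filter_upwards [hC, nhdsWithin_le_nhds hD] with t h1 h2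
    rw [Real.norm_eq_abs, mul_one] at h2
    have h2' := (le_abs_self _).trans h2
    rw [← Finset.mul_prod_erase S _ hxS]
    calc (t - x) ^ 2 * (∏ s ∈ S.erase x, (t - s) ^ 2) * ‖h t‖
        = (∏ s ∈ S.erase x, (t - s) ^ 2) * ((t - x) ^ 2 * ‖h t‖) := by ring
      _ ≤ D * ((t - x) ^ 2 * ‖h t‖) := by gcongr
      _ ≤ D * (C * √(q t)) := mul_le_mul_of_nonneg_left h1 ((abs_nonneg _).trans h2)
      _ = D * C * √(q t) := by ring
  · have hpos : 0 < √(q x) := Real.sqrt_pos.2 (lt_of_le_of_ne (hq0 x hx) (Ne.symm hqx))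
    have hP : ContinuousAt (fun t => (((∏ s ∈ S, (t - s) ^ 2 : ℝ)) : ℂ) * h t) x := by
      have := (hh x hx).continuousAt
      fun_prop
    obtain ⟨C, hC⟩ := hP.eventually_norm_le_mul (hq x hx).continuousAt.sqrt hpos
    refine ⟨C, nhdsWithin_le_nhds ?_⟩
    filter_upwards [hC] with t ht
    rwa [norm_mul, Complex.norm_real, Real.norm_of_nonneg
      (Finset.prod_nonneg fun s _ => sq_nonneg _)] at ht

/-- Near a zero `x` of `q` only the factor `(t - x)²` of the product can be small, and `√q / (t -
x)² ≤ 4 q'² / q^(3/2)` because `|q| ≤ 2 |t - x| |q'|`. Away from the zeros of `q` the term `√q`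
suffices. -/
theorem exists_le_deriv_of_prod_le {q : ℝ → ℝ} {h : ℝ → ℂ} {T : ℝ}
    (hq : AnalyticOnNhd ℝ q (Icc 0 T)) (hh : AnalyticOnNhd ℝ h (Icc 0 T))
    (hq0 : ∀ t ∈ Icc 0 T, 0 ≤ q t) (hne : ∃ t ∈ Icc 0 T, q t ≠ 0) {S : Finset ℝ} {C : ℝ}
    (hS : ∀ t ∈ Icc 0 T, (∏ s ∈ S, (t - s) ^ 2) * ‖h t‖ ≤ C * √(q t)) :
    ∃ C : ℝ, ∀ t ∈ Icc 0 T, q t ≠ 0 →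
      ‖h t‖ ≤ C * (√(q t) + deriv q t ^ 2 / (q t * √(q t))) := by
  classical
  have hr : ∀ t ∈ Icc 0 T, 0 ≤ deriv q t ^ 2 / (q t * √(q t)) := fun t ht => by
    have := hq0 t ht
    positivity
  refine isCompact_Icc.exists_le_mul_of_local
    (fun t ht _ => add_nonneg (Real.sqrt_nonneg _) (hr t ht)) fun x hx => ?_
  by_cases hqx : q x = 0
  · set G : ℝ → ℝ := fun t => ∏ s ∈ S.erase x, (t - s) ^ 2 with hG
    have hGc : ContinuousAt G x := by fun_prop
    have hGx : 0 < G x := Finset.prod_pos fun s hs => by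
      have := sub_ne_zero.2 (Finset.ne_of_mem_erase hs).symm
      positivity
    have hGe : ∀ᶠ t in 𝓝 x, G x / 2 < G t := hGc.eventually (lt_mem_nhds (by linarith))
    have hd := (hq x hx).eventually_abs_le_mul_deriv hqx (not_eventually_eq_zero hq hne hx)
    refine ⟨4 * (|C| / (G x / 2)), ?_⟩
    filter_upwards [nhdsWithin_le_nhds hGe, nhdsWithin_le_nhds hd, self_mem_nhdsWithin,
      nhdsWithin_le_nhds (Metric.ball_mem_nhds x one_pos)] with t h1 h2 h3 h4 h5
    have htx : 0 < (t - x) ^ 2 := by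
      have : t - x ≠ 0 := sub_ne_zero.2 fun h => h5 (h ▸ hqx)
      positivity
    have hpos : 0 < q t := lt_of_le_of_ne (hq0 t h3) (Ne.symm h5)
    -- If `x` is not one of the exceptional points, inserting the factor `(t - x)² ≤ 1` costs
    -- nothing.
    have h6 : (t - x) ^ 2 * G t ≤ ∏ s ∈ S, (t - s) ^ 2 := by
      by_cases hxS : x ∈ S
      · rw [hG, Finset.mul_prod_erase S (fun s => (t - s) ^ 2) hxS]
      · rw [hG, Finset.erase_eq_of_notMem hxS]
        refine mul_le_of_le_one_left (Finset.prod_nonneg fun s _ => sq_nonneg _) ?_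
        rw [Metric.mem_ball, Real.dist_eq] at h4
        rw [← sq_abs]
        exact pow_le_one₀ (abs_nonneg _) h4.le
    have h7 : ‖h t‖ ≤ |C| / (G x / 2) * (√(q t) / (t - x) ^ 2) := by
      rw [div_mul_div_comm, le_div_iff₀ (by positivity)]
      calc ‖h t‖ * (G x / 2 * (t - x) ^ 2) ≤ ‖h t‖ * (G t * (t - x) ^ 2) := by gcongr
        _ = (t - x) ^ 2 * G t * ‖h t‖ := by ring
        _ ≤ (∏ s ∈ S, (t - s) ^ 2) * ‖h t‖ := by gcongr
        _ ≤ C * √(q t) := hS t h3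
        _ ≤ |C| * √(q t) := by gcongr; exact le_abs_self C
    have h8 : √(q t) / (t - x) ^ 2 ≤ 4 * (deriv q t ^ 2 / (q t * √(q t))) := by
      rw [← mul_div_assoc, div_le_div_iff₀ htx (by positivity)]
      have e1 : √(q t) * (q t * √(q t)) = |q t| ^ 2 := by
        rw [mul_left_comm, Real.mul_self_sqrt hpos.le, sq_abs, sq]
      have e2 : 4 * deriv q t ^ 2 * (t - x) ^ 2 = (2 * |t - x| * |deriv q t|) ^ 2 := by
        rw [mul_pow, mul_pow, sq_abs, sq_abs]
        ring
      rw [e1, e2]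
      exact pow_le_pow_left₀ (abs_nonneg _) h2 2
    refine h7.trans ?_
    calc |C| / (G x / 2) * (√(q t) / (t - x) ^ 2)
        ≤ |C| / (G x / 2) * (4 * (deriv q t ^ 2 / (q t * √(q t)))) := by gcongr
      _ = 4 * (|C| / (G x / 2)) * (0 + deriv q t ^ 2 / (q t * √(q t))) := by ring
      _ ≤ _ := by gcongr; exact Real.sqrt_nonneg _
  · have hpos : 0 < √(q x) := Real.sqrt_pos.2 (lt_of_le_of_ne (hq0 x hx) (Ne.symm hqx))
    obtain ⟨D, hD⟩ := (hh x hx).continuousAt.eventually_norm_le_mul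
      (hq x hx).continuousAt.sqrt hpos
    refine ⟨|D|, ?_⟩
    filter_upwards [nhdsWithin_le_nhds hD, self_mem_nhdsWithin] with t h1 h2 _
    refine h1.trans (mul_le_mul (le_abs_self D) ?_ (Real.sqrt_nonneg _) (abs_nonneg _))
    linarith [hr t h2]

/-- Near any point of `[0, T]` there are intervals of length `r / 2` at distance between `r / 2`
and `r`. -/
theorem exists_Icc_at_distance {T x r : ℝ} (hx : x ∈ Icc 0 T) (hr : 0 < r)
    (hrT : r ≤ T / 2) : ∃ a, 0 ≤ a ∧ a + r / 2 ≤ T ∧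
      ∀ t ∈ Icc a (a + r / 2), r / 2 ≤ |t - x| ∧ |t - x| ≤ r := by
  obtain ⟨h0, hT⟩ := hx
  rcases le_total x (T / 2) with h | h
  · refine ⟨x + r / 2, by linarith, by linarith, fun t ht => ?_⟩
    rw [abs_of_nonneg (by linarith [ht.1])]
    constructor <;> linarith [ht.1, ht.2]
  · refine ⟨x - r, by linarith, by linarith, fun t ht => ?_⟩
    rw [abs_of_nonpos (by linarith [ht.2])]
    constructor <;> linarith [ht.1, ht.2]

theorem local_bound_of_integral_bound {q : ℝ → ℝ} {h : ℝ → ℂ} {T : ℝ} (hT : 0 < T)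
    (hq : AnalyticOnNhd ℝ q (Icc 0 T)) (hh : AnalyticOnNhd ℝ h (Icc 0 T))
    (hq0 : ∀ t ∈ Icc 0 T, 0 ≤ q t) (hne : ∃ t ∈ Icc 0 T, q t ≠ 0) {C : ℝ}
    (hint : ∀ R : ℝ, 1 ≤ R →
      IntervalIntegrable (fun t => √(R * ‖h t‖ / √(R ^ 2 * q t + 8))) volume 0 T ∧
      ∫ t in (0 : ℝ)..T, √(R * ‖h t‖ / √(R ^ 2 * q t + 8)) ≤ C * Real.log (1 + R))
    {x : ℝ} (hx : x ∈ Icc 0 T) :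
    ∃ C : ℝ, ∀ᶠ t in 𝓝[Icc 0 T] x, (t - x) ^ 2 * ‖h t‖ ≤ C * √(q t) := by
  by_cases hz : ∀ᶠ t in 𝓝 x, h t = 0
  · refine ⟨0, nhdsWithin_le_nhds ?_⟩
    filter_upwards [hz] with t ht
    simp [ht]
  obtain ⟨m, v, hv, hvx, hev⟩ := (hh x hx).exists_eventuallyEq_pow_smul_nonzero_iff.2 hz
  obtain ⟨k, u, hu, hux, heu⟩ := (hq x hx).exists_eventuallyEq_pow_smul_nonzero_iff.2
    (not_eventually_eq_zero hq hne hx)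
  have hball := Metric.ball_mem_nhds x one_pos
  have hnh : ∀ t, h t = (t - x) ^ m • v t → ‖h t‖ = |t - x| ^ m * ‖v t‖ := by
    intro t ht
    rw [ht, norm_smul, norm_pow, Real.norm_eq_abs]
  have hnq : ∀ t ∈ Icc 0 T, q t = (t - x) ^ k • u t → q t = |t - x| ^ k * |u t| := by
    intro t ht hqt
    rw [← abs_of_nonneg (hq0 t ht), hqt, smul_eq_mul, abs_mul, abs_pow]
  -- The estimate compares `|t - x|^(m + 2)` with `|t - x|^(k / 2)`, so it holds exactly when `k ≤
  -- 2m + 4`; larger `k` must contradict the integral bound.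
  rcases le_or_gt k (2 * m + 4) with hk | hk
  · obtain ⟨K, hK⟩ := hv.continuousAt.eventually_norm_le_mul
      (hu.continuousAt.abs.sqrt) (Real.sqrt_pos.2 (abs_pos.2 hux))
    refine ⟨K, ?_⟩
    filter_upwards [nhdsWithin_le_nhds hK, nhdsWithin_le_nhds hev, nhdsWithin_le_nhds heu,
      nhdsWithin_le_nhds hball, self_mem_nhdsWithin] with t h1 h2 h3 h4 h5
    rw [Metric.mem_ball, Real.dist_eq] at h4
    rw [hnh t h2, hnq t h5 h3, Real.sqrt_mul (by positivity)]
    have hd : |t - x| ^ (m + 2) ≤ √(|t - x| ^ k) := by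
      refine Real.le_sqrt_of_sq_le ?_
      rw [← pow_mul]
      exact pow_le_pow_of_le_one (abs_nonneg _) h4.le (by omega)
    calc (t - x) ^ 2 * (|t - x| ^ m * ‖v t‖) = |t - x| ^ (m + 2) * ‖v t‖ := by
          rw [← sq_abs]; ring
      _ ≤ √(|t - x| ^ k) * (K * √|u t|) := by gcongr
      _ = K * (√(|t - x| ^ k) * √|u t|) := by ring
  · exfalso
    obtain ⟨d, rfl⟩ : ∃ d, k = 2 * m + 5 + d := ⟨k - (2 * m + 5), by omega⟩
    obtain ⟨K, hK⟩ := hu.continuousAt.eventually_norm_le_mul (g := fun _ => 1)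
      continuousAt_const one_pos
    have hvpos : 0 < ‖v x‖ := norm_pos_iff.2 hvx
    have hvl : ∀ᶠ t in 𝓝 x, ‖v x‖ / 2 < ‖v t‖ :=
      hv.continuousAt.norm.eventually (lt_mem_nhds (by linarith))
    obtain ⟨δ, hδ, hδb⟩ := Metric.eventually_nhds_iff_ball.1
      ((hK.and hvl).and (hev.and heu))
    set c := ‖v x‖ / 2 with hc
    have hc0 : 0 < c := by positivity
    have hK0 : 0 ≤ K := by
      have := (hδb x (Metric.mem_ball_self hδ)).1.1
      rw [mul_one] at this
      exact (norm_nonneg _).trans this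
    set D := √(K + 8) with hD
    have hD0 : 0 < D := by positivity
    set c₁ := √(c / (2 ^ m * D)) with hc₁
    have hc₁0 : 0 < c₁ := by positivity
    have key : ∀ z : ℝ, 1 ≤ z → 2 / T ≤ z → 2 / δ ≤ z →
        c₁ * z ^ 2 / 2 ≤ C * Real.log (1 + z ^ (4 * (2 * m + 5 + d))) := by
      intro z hz1 hzT hzδ
      -- With `k = 2m + 5 + d`, the scales `R = z^(4k)` and `r = z⁻⁸` satisfy `R² r^k = 1`, so the
      -- denominator stays bounded at distance at most `r`. The integrand is then at least of size
      -- `√(R r^m) = z^(10 + 2d)` on an interval of length `r / 2`, giving at least `c₁ z² / 2`. All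
      -- exponents are integers.
      have hz0 : 0 < z := by linarith
      set R := z ^ (4 * (2 * m + 5 + d)) with hR
      set r := (z ^ 8)⁻¹ with hr
      have hr0 : 0 < r := by positivity
      have hrz : r ≤ z⁻¹ := inv_anti₀ hz0 (le_self_pow₀ hz1 (by norm_num))
      have hrT : r ≤ T / 2 := hrz.trans (by
        rw [inv_le_comm₀ hz0 (by positivity), inv_div]; exact hzT)
      have hrδ : r < δ := lt_of_le_of_lt hrz (by
        rw [inv_lt_comm₀ hz0 hδ]
        refine lt_of_lt_of_le ?_ hzδ
        rw [← one_div]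
        gcongr
        norm_num)
      have hR1 : 1 ≤ R := one_le_pow₀ hz1
      obtain ⟨a, ha0, haT, ha⟩ := exists_Icc_at_distance hx hr0 hrT
      obtain ⟨hi, hle⟩ := hint R hR1
      refine le_trans ?_ hle
      have hsub : Icc a (a + r / 2) ⊆ Icc 0 T := Icc_subset_Icc ha0 haT
      have hlow : ∀ t ∈ Icc a (a + r / 2),
          c₁ * z ^ (10 + 2 * d) ≤ √(R * ‖h t‖ / √(R ^ 2 * q t + 8)) := by
        intro t ht
        obtain ⟨ht1, ht2⟩ := ha t ht
        have htb : t ∈ Metric.ball x δ := by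
          rw [Metric.mem_ball, Real.dist_eq]
          linarith
        obtain ⟨⟨b1, b2⟩, b3, b4⟩ := hδb t htb
        rw [mul_one, Real.norm_eq_abs] at b1
        have e1 : √(R ^ 2 * q t + 8) ≤ D := by
          refine Real.sqrt_le_sqrt ?_
          rw [hnq t (hsub ht) b4]
          have e2 : R ^ 2 * r ^ (2 * m + 5 + d) = 1 := by
            rw [hR, hr, inv_pow, ← pow_mul, ← pow_mul]
            rw [show 4 * (2 * m + 5 + d) * 2 = 8 * (2 * m + 5 + d) by ring]
            exact mul_inv_cancel₀ (by positivity)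
          have : R ^ 2 * (|t - x| ^ (2 * m + 5 + d) * |u t|) ≤
              R ^ 2 * (r ^ (2 * m + 5 + d) * K) := by gcongr
          rw [← mul_assoc (R ^ 2) (r ^ (2 * m + 5 + d)), e2] at this
          linarith
        have e3 : R * r ^ m = (z ^ (10 + 2 * d)) ^ 2 := by
          rw [hR, hr, inv_pow, ← pow_mul, ← pow_mul, mul_inv_eq_iff_eq_mul₀ (by positivity),
            ← pow_add]
          congr 1
          ring
        have e4 : c / (2 ^ m * D) * (z ^ (10 + 2 * d)) ^ 2 ≤
            R * ‖h t‖ / √(R ^ 2 * q t + 8) := by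
          have hs0 : 0 < √(R ^ 2 * q t + 8) := by
            have := hq0 t (hsub ht)
            positivity
          calc c / (2 ^ m * D) * (z ^ (10 + 2 * d)) ^ 2 = R * ((r / 2) ^ m * c) / D := by
                rw [← e3, div_pow]
                field_simp
            _ ≤ R * (|t - x| ^ m * ‖v t‖) / √(R ^ 2 * q t + 8) := by gcongr
            _ = _ := by rw [hnh t b3]
        calc c₁ * z ^ (10 + 2 * d) = √(c / (2 ^ m * D) * (z ^ (10 + 2 * d)) ^ 2) := by
              rw [Real.sqrt_mul (by positivity), Real.sqrt_sq (by positivity)]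
          _ ≤ _ := Real.sqrt_le_sqrt e4
      have har : a ≤ a + r / 2 := by linarith
      have hconst : c₁ * z ^ 2 / 2 ≤ ∫ _ in a..(a + r / 2), c₁ * z ^ (10 + 2 * d) := by
        rw [intervalIntegral.integral_const, add_sub_cancel_left, smul_eq_mul]
        have e5 : r * z ^ (10 + 2 * d) = z ^ (2 + 2 * d) := by
          rw [hr, inv_mul_eq_iff_eq_mul₀ (by positivity), ← pow_add]
          congr 1
          ring
        have e6 : z ^ 2 ≤ z ^ (2 + 2 * d) := pow_le_pow_right₀ hz1 (by omega)
        calc c₁ * z ^ 2 / 2 ≤ c₁ * z ^ (2 + 2 * d) / 2 := by gcongr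
          _ = r / 2 * (c₁ * z ^ (10 + 2 * d)) := by rw [← e5]; ring
      refine hconst.trans ((intervalIntegral.integral_mono_on har intervalIntegrable_const
        (hi.mono_set ?_) hlow).trans ?_)
      · rw [uIcc_of_le har, uIcc_of_le hT.le]
        exact hsub
      · exact intervalIntegral.integral_mono_interval ha0 har haT
          (Eventually.of_forall fun t => Real.sqrt_nonneg _) hi
    set k : ℕ := 4 * (2 * m + 5 + d) with hkdef
    have hlog : ∀ z : ℝ, 1 ≤ z → Real.log (1 + z ^ k) ≤ (1 + k) * z := by
      intro z hz1
      have h1 : 1 ≤ z ^ k := one_le_pow₀ hz1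
      calc Real.log (1 + z ^ k) ≤ Real.log (2 * z ^ k) :=
            Real.log_le_log (by positivity) (by linarith)
        _ = Real.log 2 + k * Real.log z := by
            rw [Real.log_mul (by norm_num) (by positivity), Real.log_pow]
        _ ≤ 1 + k * z := by
            have h2 := Real.log_two_lt_d9
            have h3 := Real.log_le_sub_one_of_pos (show 0 < z by linarith)
            gcongr <;> linarith
        _ ≤ (1 + k) * z := by linarith
    -- The last entry makes `c₁ z² / 2` exceed the bound `|C| (1 + k) z` on the logarithmic side.
    set z := max (max 1 (2 / T)) (max (2 / δ) (2 * |C| * (1 + k) / c₁ + 1)) with hz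
    have z1 : 1 ≤ z := (le_max_left _ _).trans (le_max_left _ _)
    have z2 : 2 / T ≤ z := (le_max_right _ _).trans (le_max_left _ _)
    have z3 : 2 / δ ≤ z := (le_max_left _ _).trans (le_max_right _ _)
    have z4 : 2 * |C| * (1 + k) / c₁ + 1 ≤ z := (le_max_right _ _).trans (le_max_right _ _)
    have h1 := key z z1 z2 z3
    have h2 : C * Real.log (1 + z ^ k) ≤ |C| * ((1 + k) * z) :=
      mul_le_mul (le_abs_self C) (hlog z z1) (Real.log_nonneg (by
        have : 0 ≤ z ^ k := by positivity
        linarith)) (abs_nonneg C)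
    have h3 : 2 * |C| * (1 + k) / c₁ < z := by linarith
    rw [div_lt_iff₀ hc₁0] at h3
    nlinarith

end OneVariable

/-! ### One space dimension -/

namespace ThirdOrderOperator

open Set Filter Topology MeasureTheory

variable {P : ThirdOrderOperator 1} {T : ℝ}

/-- The unit vector of `ℝ¹`. -/
noncomputable abbrev unitVec : EuclideanSpace ℝ (Fin 1) := EuclideanSpace.single 0 1

theorem eq_smul_unitVec (ξ : EuclideanSpace ℝ (Fin 1)) : ξ = ξ 0 • unitVec := by
  ext i
  fin_cases i
  simp

theorem AnalyticCoefficients.disc_eq (h : P.AnalyticCoefficients T) (t : ℝ)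
    (ξ : EuclideanSpace ℝ (Fin 1)) : P.disc t ξ = ξ 0 ^ 2 * P.disc t unitVec := by
  rw [← h.disc_smul, ← eq_smul_unitVec]

theorem AnalyticCoefficients.norm_mid_eq (h : P.AnalyticCoefficients T) (t : ℝ)
    (ξ : EuclideanSpace ℝ (Fin 1)) : ‖P.mid t ξ‖ = |ξ 0| * ‖P.mid t unitVec‖ := by
  rw [← Real.norm_eq_abs, ← Complex.norm_real, ← norm_mul, ← h.mid_smul, ← eq_smul_unitVec]

theorem sqrt_sq_mul (a b : ℝ) : √(a ^ 2 * b) = |a| * √b := by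
  rw [Real.sqrt_mul (sq_nonneg a), Real.sqrt_sq_eq_abs]

theorem IntegralLevi.productLevi (hB : P.IntegralLevi T) (h : P.AnalyticCoefficients T)
    (hP : P.WeaklyHyperbolic T) (hT : 0 < T) (hne : ∃ t ∈ Icc 0 T, P.disc t unitVec ≠ 0) :
    P.ProductLevi T := by
  obtain ⟨C, hC⟩ := (integralLevi_iff h hP hT).1 hB
  have hq := h.disc_analytic unitVec
  have hm := h.mid_analytic unitVec
  have hq0 : ∀ t ∈ Icc 0 T, 0 ≤ P.disc t unitVec := fun t ht => hP.disc_nonneg ht _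
  -- Positive multiples of one unit vector suffice: `R • unitVec` has norm `R`, and the frequency
  -- becomes the parameter `R`.
  obtain ⟨S, D, hS⟩ := exists_prod_le_of_local hq hm hq0 hne fun x hx _ => by
    refine local_bound_of_integral_bound (C := C) hT hq hm hq0 hne (fun R hR => ?_) hx
    have hnorm : ‖R • unitVec‖ = R := by
      rw [norm_smul, Real.norm_of_nonneg (by linarith), PiLp.norm_single, norm_one, mul_one]
    have hden : P.density (R • unitVec) = fun t =>
        √(R * ‖P.mid t unitVec‖ / √(R ^ 2 * P.disc t unitVec + 8)) := by
      funext t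
      rw [density, h.disc_smul, h.mid_smul, norm_mul, Complex.norm_real,
        Real.norm_of_nonneg (by linarith)]
    have h1 := hC (R • unitVec) (by rwa [hnorm])
    have h2 := (continuousOn_density h hP (R • unitVec)).intervalIntegrable_of_Icc hT.le
      (μ := volume)
    rw [hden] at h1 h2
    rw [hnorm] at h1
    exact ⟨h2, h1⟩
  refine (productLevi_iff h hP).2 ⟨S, D, fun t ht ξ => ?_⟩
  rw [h.disc_eq, h.norm_mid_eq, sqrt_sq_mul, mul_left_comm, mul_left_comm D]
  exact mul_le_mul_of_nonneg_left (hS t ht) (abs_nonneg _)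

/-- Both sides of the pointwise bound are homogeneous of degree one in `|ξ|`, so it only has to be
shown for the unit vector. -/
theorem ProductLevi.pointwiseLevi (hC : P.ProductLevi T) (h : P.AnalyticCoefficients T)
    (hP : P.WeaklyHyperbolic T) (hT : 0 < T) (hne : ∃ t ∈ Icc 0 T, P.disc t unitVec ≠ 0) :
    P.PointwiseLevi T := by
  obtain ⟨S, C, hS⟩ := (productLevi_iff h hP).1 hC
  obtain ⟨D, hD⟩ := exists_le_deriv_of_prod_le (h.disc_analytic unitVec) (h.mid_analytic unitVec)
    (fun t ht => hP.disc_nonneg ht _) hne (fun t ht => hS t ht unitVec)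
  refine (pointwiseLevi_iff h hP hT).2 ⟨D, fun t ht ξ hξ => ?_⟩
  have hder : deriv (fun s => P.disc s ξ) t = ξ 0 ^ 2 * deriv (fun s => P.disc s unitVec) t := by
    rw [funext fun s => h.disc_eq s ξ]
    exact deriv_const_mul_field _
  rw [h.disc_eq] at hξ
  have hξ0 : ξ 0 ≠ 0 := fun h0 => hξ (by rw [h0]; ring)
  have hd0 : P.disc t unitVec ≠ 0 := right_ne_zero_of_mul hξ
  have hpos : 0 < P.disc t unitVec := lt_of_le_of_ne (hP.disc_nonneg ht _) hd0.symm
  have habs : 0 < |ξ 0| := abs_pos.2 hξ0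
  rw [hder, h.disc_eq, h.norm_mid_eq, sqrt_sq_mul, ← sq_abs (ξ 0)]
  refine (mul_le_mul_of_nonneg_left (hD t ht hd0) habs.le).trans (le_of_eq ?_)
  field_simp

end ThirdOrderOperator

theorem mainTheorem10 {n : ℕ} (P : ThirdOrderOperator n) {T : ℝ} (hT : 0 < T)
    (hanalytic : P.AnalyticCoefficients T) (hhyp : P.WeaklyHyperbolic T)
    (hΔ : ∃ t ∈ Set.Icc 0 T, ∃ ξ : EuclideanSpace ℝ (Fin n), P.Δ t ξ ≠ 0) :
    (P.PointwiseLevi T → P.IntegralLevi T) ∧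
    (n = 1 →
      (P.PointwiseLevi T ↔ P.IntegralLevi T) ∧ (P.PointwiseLevi T ↔ P.ProductLevi T)) := by
  obtain ⟨t, ht, η, hη⟩ := hΔ
  rw [(hhyp.disc_spec ht η).2.1] at hη
  have hAB : P.PointwiseLevi T → P.IntegralLevi T := fun hA =>
    hA.integralLevi hanalytic hhyp hT ⟨η, t, ht, hη⟩
  refine ⟨hAB, ?_⟩
  rintro rfl
  have hne : ∃ t ∈ Set.Icc 0 T, P.disc t ThirdOrderOperator.unitVec ≠ 0 := by
    rw [hanalytic.disc_eq] at hη
    exact ⟨t, ht, right_ne_zero_of_mul hη⟩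
  have hBC : P.IntegralLevi T → P.ProductLevi T := fun hB =>
    hB.productLevi hanalytic hhyp hT hne
  have hCA : P.ProductLevi T → P.PointwiseLevi T := fun hC =>
    hC.pointwiseLevi hanalytic hhyp hT hne
  exact ⟨⟨hAB, fun hB => hCA (hBC hB)⟩, fun hA => hBC (hAB hA), hCA⟩
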